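/- **Setting.** A *two-colored partition* $p$ consists of $k\ge 0$ upper points and $l\ge 0$ lower points, each row numbered from left to right, a color in $\{\circ,\bullet\}$ for every point, and a partition of the set of all points into non-empty *blocks*; the elements of a block are its *legs*. Let $\overline{\circ}=\bullet$, $\overline{\bullet}=\circ$. A *category* is a set $\mathcal C$ of two-colored partitions which contains, for each color $c$, the partition with one upper and one lower point, both of color $c$ and in one block, and the partition with no upper and two lower points of colors $c,\overline c$ in one block, and which is closed under tensor products (horizontal concatenation), involution (reflection at the horizontal axis, colors kept), and composition of composable pairs (vertical concatenation where the colors of the identified rows agree; the middle row is then removed). It is *non-hyperoctahedral* if it contains the partition with two lower points $\circ\bullet$ (and no upper points) that are both singleton blocks, or if it does not contain the partition with four lower points $\circ\bullet\circ\bullet$ (and no upper points) forming a single block. The *normalized color* of a lower point is its color, that of an upper point is the inverse of its color. The *color sum* $\sigma_p(S)$ of a set $S$ of points is the number of points of normalized color $\circ$ in $S$ minus the number of points of normalized color $\bullet$ in $S$; $\Sigma(p)$ is the color sum of the set of all points. The points are cyclically ordered by running through the lower row from left to right and then through the upper row from right to left, and $]\alpha,\beta[_p$, $]\alpha,\beta]_p$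 denote intervals with respect to this cyclic order. For points $\alpha\ne\beta$ the *color distance* $\delta_p(\alpha,\beta)$ is $\sigma_p(]\alpha,\beta]_p)$ if $\alpha,\beta$ have the same normalized color, and $\sigma_p(]\alpha,\beta[_p)$ otherwise. Blocks $B_1\ne B_2$ *cross* if there are $\alpha_1,\beta_1\in B_1$ and $\alpha_2,\beta_2\in B_2$ met in the cyclic order $(\alpha_1,\alpha_2,\beta_1,\beta_2)$. For a category $\mathcal C$ and $c_1,c_2\in\{\circ,\bullet\}$ let $\Sigma(\mathcal C)=\{\Sigma(p)\mid p\in\mathcal C\}$. Call a pair $(\alpha_1,\alpha_2)$ *subsequent* in $p$ if $\alpha_1\ne\alpha_2$ are legs of one block $B$ of $p$ with $]\alpha_1,\alpha_2[_p\cap B=\emptyset$. Let $L(\mathcal C)$, respectively $K(\mathcal C)$, be the set of all $\delta_p(\alpha_1,\alpha_2)$ where $p\in\mathcal C$ and $(\alpha_1,\alpha_2)$ is subsequent in $p$ with $\sigma_p(\{\alpha_1,\alpha_2\})\neq 0$, respectively $\sigma_p(\{\alpha_1,\alpha_2\})=0$; let $K_{c_1,c_2}(\mathcal C)$ be the set of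 all $\delta_p(\alpha_1,\alpha_2)$ where $p\in\mathcal C$ and $(\alpha_1,\alpha_2)$ is subsequent in $p$ with $\alpha_i$ of normalized color $c_i$ for $i=1,2$. Let $X(\mathcal C)$ be the set of all $\delta_p(\alpha_1,\alpha_2)$ where $p\in\mathcal C$ and $\alpha_1\in B_1$, $\alpha_2\in B_2$ for crossing blocks $B_1,B_2$ of $p$; let $X_{c_1,c_2}(\mathcal C)$ be the subset obtained by requiring in addition that $\alpha_i$ has normalized color $c_i$ for $i=1,2$. For $m\in\mathbb Z$ and $D\subseteq\mathbb Z$ put $D_m=(D\cup(m-D))+m\mathbb Z$. **Proposition.** Let $\mathcal C$ be a non-hyperoctahedral category of two-colored partitions. Then $$L(\mathcal C)=K_{\circ\circ}(\mathcal C)=K_{\bullet\bullet}(\mathcal C),\qquad K(\mathcal C)=K_{\circ\bullet}(\mathcal C)=K_{\bullet\circ}(\mathcal C),$$ $$X(\mathcal C)=X_{\circ\circ}(\mathcal C)=X_{\bullet\bullet}(\mathcal C)=X_{\circ\bullet}(\mathcal C)=X_{\bullet\circ}(\mathcal C),$$ and there exist integers $u\ge 0$ and $m\ge 1$ and sets $D\subseteq\{0,1,\dots,\lfloor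 m/2\rfloor\}$ and $E\subseteq\{0,1,2,\dots\}$ such that the tuple $(\Sigma,L,K,X)(\mathcal C)$ is one of the following: 1. $(um\mathbb Z,\ m\mathbb Z,\ m\mathbb Z,\ \mathbb Z\setminus D_m)$, 2. $(2um\mathbb Z,\ m+2m\mathbb Z,\ 2m\mathbb Z,\ \mathbb Z\setminus D_m)$, 3. $(um\mathbb Z,\ \emptyset,\ m\mathbb Z,\ \mathbb Z\setminus D_m)$, 4. $(\{0\},\ \{0\},\ \{0\},\ \mathbb Z\setminus E_0)$, 5. $(\{0\},\ \emptyset,\ \{0\},\ \mathbb Z\setminus E_0)$. -/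

import Mathlib

/-- The two colors `∘` (white) and `•` (black). -/
inductive PColor : Type
  | white : PColor
  | black : PColor

namespace PColor

/-- The inverse color: white and black are swapped. -/
def inv : PColor → PColor
  | white => black
  | black => white

/-- White counts `1`, black counts `-1` in color sums. -/
def sign : PColor → ℤ
  | white => 1
  | black => -1

end PColor

/-- The points of a partition with `k` upper points (`Sum.inl`) and `l` lower points (`Sum.inr`),
both rows being numbered from left to right. -/
abbrev PPoint (k l : ℕ) : Type := Fin k ⊕ Fin l

/-- A two-colored partition with `k` upper and `l` lower points: a coloring of the points together
with a partition of the set of points, given as an equivalence relation whose classes are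
the blocks. -/
structure TCPartition (k l : ℕ) : Type where
  upper : Fin k → PColor
  lower : Fin l → PColor
  rel : Setoid (PPoint k l)

namespace TCPartition

/-! ### Category operations -/

/-- The identity partition: one upper and one lower point of the same color `c`, connected. -/
def ident (c : PColor) : TCPartition 1 1 where
  upper := fun _ => c
  lower := fun _ => c
  rel := ⊤

/-- The lower pair partition: two connected lower points, the left one of color `c`,
the right one of the inverse color. -/
def lowerPair (c : PColor) : TCPartition 0 2 where
  upper := ![]
  lower := ![c, c.inv]
  rel := ⊤

/-- Two lower singletons, the left one white, the right one black. -/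
def singletonsWB : TCPartition 0 2 where
  upper := ![]
  lower := ![PColor.white, PColor.black]
  rel := ⊥

/-- One block of four lower points, colored white, black, white, black. -/
def fourWBWB : TCPartition 0 4 where
  upper := ![]
  lower := ![PColor.white, PColor.black, PColor.white, PColor.black]
  rel := ⊤

/-- The disjoint union of two equivalence relations. -/
def sumRel {α β : Type} (r : Setoid α) (s : Setoid β) : Setoid (α ⊕ β) where
  r := Sum.LiftRel r.r s.r
  iseqv :=
    { refl := by
        rintro (a | b)
        · exact Sum.LiftRel.inl (r.refl a)
        · exact Sum.LiftRel.inr (s.refl b)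
      symm := by
        rintro _ _ (h | h)
        · exact Sum.LiftRel.inl (r.symm h)
        · exact Sum.LiftRel.inr (s.symm h)
      trans := by
        rintro _ _ _ (h | h) (h' | h')
        · exact Sum.LiftRel.inl (r.trans h h')
        · exact Sum.LiftRel.inr (s.trans h h') }

/-- The points of a horizontal concatenation, sorted by the partition they stem from. -/
def splitPoints (k k' l l' : ℕ) : PPoint (k + k') (l + l') ≃ PPoint k l ⊕ PPoint k' l' :=
  (Equiv.sumCongr finSumFinEquiv.symm finSumFinEquiv.symm).trans
    (Equiv.sumSumSumComm (Fin k) (Fin k') (Fin l) (Fin l'))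

/-- The tensor product: `q` is placed to the right of `p`. -/
def tensor {k l k' l' : ℕ} (p : TCPartition k l) (q : TCPartition k' l') :
    TCPartition (k + k') (l + l') where
  upper := Fin.append p.upper q.upper
  lower := Fin.append p.lower q.lower
  rel := (sumRel p.rel q.rel).comap (splitPoints k k' l l')

/-- The involution: reflection at the horizontal axis, which swaps the two rows. -/
def star {k l : ℕ} (p : TCPartition k l) : TCPartition l k where
  upper := p.lower
  lower := p.upper
  rel := p.rel.comap Sum.swap

/-- The relation induced on upper, middle and lower row when `p` is put on top of `q` and the
lower row of `p` is identified with the upper row of `q`. -/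
def glued {k l m : ℕ} (p : TCPartition k l) (q : TCPartition l m) :
    Setoid (Fin k ⊕ (Fin l ⊕ Fin m)) :=
  Relation.EqvGen.setoid fun x y =>
    (∃ a b : PPoint k l, p.rel a b ∧ x = Sum.map id Sum.inl a ∧ y = Sum.map id Sum.inl b) ∨
    (∃ a b : PPoint l m, q.rel a b ∧ x = Sum.inr a ∧ y = Sum.inr b)

/-- The composition of `p` (above) and `q` (below). It is only meaningful for composable pairs,
i.e. if the colors of the lower row of `p` and the upper row of `q` agree. -/
def comp {k l m : ℕ} (p : TCPartition k l) (q : TCPartition l m) : TCPartition k m where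
  upper := p.upper
  lower := q.lower
  rel := (glued p q).comap (Sum.map id Sum.inr)

/-! ### Orientation, color sum and color distance -/

/-- The position of a point in the cyclic order: the lower row is traversed from left to right,
then the upper row from right to left. -/
def pos {k l : ℕ} : PPoint k l → ℕ
  | Sum.inr j => j
  | Sum.inl i => l + i.rev

/-- `(α, β, γ)` is ordered: the three points are pairwise distinct and are met in this cyclic
order. -/
def Ordered₃ {k l : ℕ} (α β γ : PPoint k l) : Prop :=
  (pos α < pos β ∧ pos β < pos γ) ∨ (pos β < pos γ ∧ pos γ < pos α) ∨
    (pos γ < pos α ∧ pos α < pos β)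

/-- `(α, β, γ, ε)` is ordered: the four points are pairwise distinct and are met in this cyclic
order. -/
def Ordered₄ {k l : ℕ} (α β γ ε : PPoint k l) : Prop :=
  Ordered₃ α β γ ∧ Ordered₃ α γ ε

open Classical in
/-- The open interval `]α, β[` with respect to the cyclic order (for `α ≠ β`). -/
noncomputable def Ioo {k l : ℕ} (α β : PPoint k l) : Finset (PPoint k l) :=
  {γ | Ordered₃ α γ β}

open Classical in
/-- The half-open interval `]α, β]` with respect to the cyclic order (for `α ≠ β`). -/
noncomputable def Ioc {k l : ℕ} (α β : PPoint k l) : Finset (PPoint k l) :=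
  {γ | γ ≠ α ∧ (γ = β ∨ Ordered₃ α γ β)}

variable {k l : ℕ}

/-- The normalized color: the color for lower points, the inverse color for upper points. -/
def normColor (p : TCPartition k l) : PPoint k l → PColor
  | Sum.inl i => (p.upper i).inv
  | Sum.inr j => p.lower j

/-- The color sum `σ_p(S)`: the number of points of normalized color `∘` in `S` minus the number of
points of normalized color `•` in `S`. -/
def colorSum (p : TCPartition k l) (S : Finset (PPoint k l)) : ℤ :=
  ∑ α ∈ S, (p.normColor α).sign

/-- The total color sum `Σ(p)`. -/
def totalColorSum (p : TCPartition k l) : ℤ := p.colorSum Finset.univ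

open Classical in
/-- The color distance `δ_p(α, β)` from `α` to `β`. -/
noncomputable def colorDist (p : TCPartition k l) (α β : PPoint k l) : ℤ :=
  if p.normColor α = p.normColor β then p.colorSum (Ioc α β) else p.colorSum (Ioo α β)

/-- The set of blocks. -/
def blocks (p : TCPartition k l) : Set (Set (PPoint k l)) := p.rel.classes

/-- Two sets of points (blocks) cross: they are distinct and there are `α₁, β₁ ∈ B₁` and
`α₂, β₂ ∈ B₂` such that `(α₁, α₂, β₁, β₂)` is ordered. -/
def Cross (B₁ B₂ : Set (PPoint k l)) : Prop :=
  B₁ ≠ B₂ ∧ ∃ α₁ ∈ B₁, ∃ β₁ ∈ B₁, ∃ α₂ ∈ B₂, ∃ β₂ ∈ B₂, Ordered₄ α₁ α₂ β₁ β₂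

/-- `α₁` and `α₂` are distinct legs of the block `B` of `p` and no leg of `B` lies strictly between
`α₁` and `α₂`. -/
def Subsequent (p : TCPartition k l) (B : Set (PPoint k l)) (α₁ α₂ : PPoint k l) : Prop :=
  B ∈ p.blocks ∧ α₁ ∈ B ∧ α₂ ∈ B ∧ α₁ ≠ α₂ ∧ (Ioo α₁ α₂ : Set (PPoint k l)) ∩ B = ∅

end TCPartition

/-- A set of two-colored partitions, sorted by the numbers of upper and lower points. -/
abbrev TCPartitionSet : Type := ∀ k l : ℕ, Set (TCPartition k l)

namespace TCPartitionSet

open TCPartition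

/-- A category of two-colored partitions: it contains the identity partitions and the lower pair
partitions with distinct colors, and it is closed under tensor products, involution, and composition
of composable pairs. -/
structure IsCategory (C : TCPartitionSet) : Prop where
  ident_mem : ∀ c : PColor, ident c ∈ C 1 1
  lowerPair_mem : ∀ c : PColor, lowerPair c ∈ C 0 2
  tensor_mem : ∀ {k l k' l' : ℕ} (p : TCPartition k l) (q : TCPartition k' l'),
    p ∈ C k l → q ∈ C k' l' → p.tensor q ∈ C (k + k') (l + l')
  star_mem : ∀ {k l : ℕ} (p : TCPartition k l), p ∈ C k l → p.star ∈ C l k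
  comp_mem : ∀ {k l m : ℕ} (p : TCPartition k l) (q : TCPartition l m),
    p ∈ C k l → q ∈ C l m → p.lower = q.upper → p.comp q ∈ C k m

/-- A non-hyperoctahedral category. -/
def IsNonHyperoctahedral (C : TCPartitionSet) : Prop :=
  C.IsCategory ∧ (singletonsWB ∈ C 0 2 ∨ fourWBWB ∉ C 0 4)

/-- The set `Σ(S)` of total color sums. -/
def Sig (S : TCPartitionSet) : Set ℤ :=
  {z | ∃ (k l : ℕ) (p : TCPartition k l), p ∈ S k l ∧ z = p.totalColorSum}

/-- The set `L(S)` of color distances between subsequent legs of the same block with the same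
normalized color. -/
def L (S : TCPartitionSet) : Set ℤ :=
  {z | ∃ (k l : ℕ) (p : TCPartition k l) (B : Set (PPoint k l)) (α₁ α₂ : PPoint k l),
    p ∈ S k l ∧ p.Subsequent B α₁ α₂ ∧ p.colorSum {α₁, α₂} ≠ 0 ∧ z = p.colorDist α₁ α₂}

/-- The set `K(S)` of color distances between subsequent legs of the same block with different
normalized colors. -/
def K (S : TCPartitionSet) : Set ℤ :=
  {z | ∃ (k l : ℕ) (p : TCPartition k l) (B : Set (PPoint k l)) (α₁ α₂ : PPoint k l),
    p ∈ S k l ∧ p.Subsequent B α₁ α₂ ∧ p.colorSum {α₁, α₂} = 0 ∧ z = p.colorDist α₁ α₂}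

/-- The set `X(S)` of color distances between legs of crossing blocks. -/
def X (S : TCPartitionSet) : Set ℤ :=
  {z | ∃ (k l : ℕ) (p : TCPartition k l) (B₁ B₂ : Set (PPoint k l)) (α₁ α₂ : PPoint k l),
    p ∈ S k l ∧ B₁ ∈ p.blocks ∧ B₂ ∈ p.blocks ∧ Cross B₁ B₂ ∧ α₁ ∈ B₁ ∧ α₂ ∈ B₂ ∧
      z = p.colorDist α₁ α₂}

/-- The set `K_{c₁,c₂}(S)` of color distances between subsequent legs of the same block, the first
of normalized color `c₁`, the second of normalized color `c₂`. -/
def Kcol (c₁ c₂ : PColor) (S : TCPartitionSet) : Set ℤ :=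
  {z | ∃ (k l : ℕ) (p : TCPartition k l) (B : Set (PPoint k l)) (α₁ α₂ : PPoint k l),
    p ∈ S k l ∧ p.Subsequent B α₁ α₂ ∧ p.normColor α₁ = c₁ ∧ p.normColor α₂ = c₂ ∧
      z = p.colorDist α₁ α₂}

/-- The set `X_{c₁,c₂}(S)` of color distances between legs of crossing blocks, the first
of normalized color `c₁`, the second of normalized color `c₂`. -/
def Xcol (c₁ c₂ : PColor) (S : TCPartitionSet) : Set ℤ :=
  {z | ∃ (k l : ℕ) (p : TCPartition k l) (B₁ B₂ : Set (PPoint k l)) (α₁ α₂ : PPoint k l),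
    p ∈ S k l ∧ B₁ ∈ p.blocks ∧ B₂ ∈ p.blocks ∧ Cross B₁ B₂ ∧ α₁ ∈ B₁ ∧ α₂ ∈ B₂ ∧
      p.normColor α₁ = c₁ ∧ p.normColor α₂ = c₂ ∧ z = p.colorDist α₁ α₂}

end TCPartitionSet

/-- The coset `a + bℤ`. -/
def intCoset (a b : ℤ) : Set ℤ := {x | ∃ z : ℤ, x = a + b * z}

/-- The set `D_m = (D ∪ (m - D)) + mℤ`. -/
def symPeriodic (D : Set ℤ) (m : ℤ) : Set ℤ :=
  {x | ∃ d ∈ D, ∃ z : ℤ, x = d + m * z ∨ x = (m - d) + m * z}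

/-! Bending the upper row down turns a partition into a word of colored points labelled by their
blocks, read cyclically. On words the category operations become rotation, reflection with inverted
colors (`bar`), insertion of one word into another, and erasure of two neighboring points of inverse
colors, which joins their blocks. The color distance is the color sum strictly between the two
points plus `offset`, half the sum of their signs, so distances add up when words are glued.

Gluing an end leg of color `c` to a start leg of color `c.inv` gives `K_{c₁,c} + K_{c.inv,c₂} ⊆
K_{c₁,c₂}` (`add_mem_wordK`), and likewise with `X` in place of the second `K` (`add_mem_wordX`).
Reflection gives negatives (`neg_mem_wordK`, `neg_mem_wordX`), and inserting a word between the legs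
of a pair gives `Σ ⊆ K` (`wordSig_subset_wordK`).

Non-hyperoctahedrality makes the colors irrelevant. Every value in `K_{c₁,c₂}` is attained on a
block with exactly two legs (`exists_two_legs`): extra legs can be cut off by singletons, or else a
third leg would produce the forbidden four-block. Comparing the two arcs between these legs inverts
both colors (`wordK_subset_inv`); detouring through another leg of the same block does the same for
`X` (`wordX_subset_inv_left`).

Hence `Σ ≤ K` are subgroups of `ℤ`, `L` is empty or a coset of `K` with `L + L ⊆ K`, and `X` is
symmetric and invariant under `K` and `L`. The five cases are the arithmetic possibilities
(`exists_parameters`). -/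

namespace PColor

@[simp] theorem inv_inv (c : PColor) : c.inv.inv = c := by cases c <;> rfl

@[simp] theorem sign_inv (c : PColor) : c.inv.sign = -c.sign := by cases c <;> rfl

end PColor

/-! ### Words of colored, labelled points -/

/-- A word of colored points, each labelled by the block it belongs to. -/
abbrev LWord (α : Type) : Type := List (PColor × α)

namespace LWord

variable {α β γ : Type}

/-- Relabelling of the blocks of a word. -/
def lmap (φ : α → β) (w : LWord α) : LWord β := w.map (Prod.map id φ)

/-- The reflected word with inverted colors. -/
def bar (w : LWord α) : LWord α := (w.map (Prod.map PColor.inv id)).reverse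

/-- The color sum of a word. -/
def csum (w : LWord α) : ℤ := (w.map fun x => x.1.sign).sum

/-- The sequence of block labels of a word. -/
def labels (w : LWord α) : List α := w.map Prod.snd

@[simp] theorem lmap_nil (φ : α → β) : lmap φ [] = [] := rfl
@[simp] theorem lmap_cons (φ : α → β) (x : PColor × α) (w : LWord α) :
    lmap φ (x :: w) = (x.1, φ x.2) :: lmap φ w := rfl
@[simp] theorem lmap_append (φ : α → β) (v w : LWord α) :
    lmap φ (v ++ w) = lmap φ v ++ lmap φ w := List.map_append
@[simp] theorem lmap_lmap (φ : α → β) (ψ : β → γ) (w : LWord α) :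
    lmap ψ (lmap φ w) = lmap (ψ ∘ φ) w := by
  simp [lmap, Function.comp_def]
@[simp] theorem lmap_id (w : LWord α) : lmap id w = w := by simp [lmap]

theorem eq_of_lmap_eq {φ ψ : α → β} {w : LWord α} (h : lmap φ w = lmap ψ w) :
    ∀ x ∈ w, φ x.2 = ψ x.2 := fun x hx => by
  have := List.map_inj_left.1 h x hx
  simpa [Prod.map] using this

@[simp] theorem bar_nil : bar ([] : LWord α) = [] := rfl
@[simp] theorem bar_cons (x : PColor × α) (w : LWord α) :
    bar (x :: w) = bar w ++ [(x.1.inv, x.2)] := by simp [bar, Prod.map]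
@[simp] theorem bar_append (v w : LWord α) : bar (v ++ w) = bar w ++ bar v := by simp [bar]
@[simp] theorem bar_bar (w : LWord α) : bar (bar w) = w := by
  induction w with
  | nil => rfl
  | cons x w ih => simp [ih]
@[simp] theorem bar_lmap (φ : α → β) (w : LWord α) : bar (lmap φ w) = lmap φ (bar w) := by
  induction w with
  | nil => rfl
  | cons x w ih => simp [ih]

@[simp] theorem csum_nil : csum ([] : LWord α) = 0 := rfl
@[simp] theorem csum_cons (x : PColor × α) (w : LWord α) :
    csum (x :: w) = x.1.sign + csum w := by simp [csum]
@[simp] theorem csum_append (v w : LWord α) : csum (v ++ w) = csum v + csum w := by simp [csum]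
@[simp] theorem csum_lmap (φ : α → β) (w : LWord α) : csum (lmap φ w) = csum w := by
  simp [csum, lmap, Function.comp_def]
@[simp] theorem csum_bar (w : LWord α) : csum (bar w) = -csum w := by
  induction w with
  | nil => rfl
  | cons x w ih => simp [ih]

@[simp] theorem labels_nil : labels ([] : LWord α) = [] := rfl
@[simp] theorem labels_cons (x : PColor × α) (w : LWord α) :
    labels (x :: w) = x.2 :: labels w := rfl
@[simp] theorem labels_append (v w : LWord α) : labels (v ++ w) = labels v ++ labels w := by
  simp [labels]
@[simp] theorem labels_lmap (φ : α → β) (w : LWord α) :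
    labels (lmap φ w) = (labels w).map φ := by
  simp [labels, lmap, Function.comp_def]
@[simp] theorem labels_bar (w : LWord α) : labels (bar w) = (labels w).reverse := by
  induction w with
  | nil => rfl
  | cons x w ih => simp [ih]

theorem mem_labels_of_mem {x : PColor × α} {w : LWord α} (h : x ∈ w) : x.2 ∈ labels w :=
  List.mem_map_of_mem h

end LWord

open LWord

/-! ### Composition described by block labellings -/

namespace TCPartition

variable {k l m : ℕ} {α β γ : Type}

/-- The upper row of a partition as a word. -/
def upperWord (p : TCPartition k l) (f : PPoint k l → α) : LWord α :=
  List.ofFn fun i => (p.upper i, f (Sum.inl i))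

/-- The lower row of a partition as a word. -/
def lowerWord (p : TCPartition k l) (f : PPoint k l → α) : LWord α :=
  List.ofFn fun j => (p.lower j, f (Sum.inr j))

/-- The generated relation is a pushout, and `hc` is its universal property on the outer points:
labels merged by `φ` and `ψ` are merged by every compatible pair. This replaces following chains
through the middle row. -/
theorem comp_rel_iff (p : TCPartition k l) (q : TCPartition l m)
    (f : PPoint k l → α) (g : PPoint l m → β)
    (hf : ∀ x y, p.rel x y ↔ f x = f y) (hg : ∀ x y, q.rel x y ↔ g x = g y)
    (φ : α → γ) (ψ : β → γ) (hmid : ∀ i, φ (f (Sum.inr i)) = ψ (g (Sum.inl i)))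
    (hc : ∀ (T : Type) (F : α → T) (G : β → T), (∀ i, F (f (Sum.inr i)) = G (g (Sum.inl i))) →
      ∀ x y : PPoint k m,
        Sum.elim (φ ∘ f ∘ Sum.inl) (ψ ∘ g ∘ Sum.inr) x =
          Sum.elim (φ ∘ f ∘ Sum.inl) (ψ ∘ g ∘ Sum.inr) y →
        Sum.elim (F ∘ f ∘ Sum.inl) (G ∘ g ∘ Sum.inr) x =
          Sum.elim (F ∘ f ∘ Sum.inl) (G ∘ g ∘ Sum.inr) y)
    (x y : PPoint k m) :
    (p.comp q).rel x y ↔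
      Sum.elim (φ ∘ f ∘ Sum.inl) (ψ ∘ g ∘ Sum.inr) x =
        Sum.elim (φ ∘ f ∘ Sum.inl) (ψ ∘ g ∘ Sum.inr) y := by
  constructor
  · intro h
    have key : glued p q ≤ Setoid.ker
        (Sum.elim (φ ∘ f ∘ Sum.inl) (ψ ∘ g) : Fin k ⊕ (Fin l ⊕ Fin m) → γ) := by
      refine Setoid.eqvGen_le ?_
      rintro _ _ (⟨a, b, hab, rfl, rfl⟩ | ⟨a, b, hab, rfl, rfl⟩)
      · have hv : ∀ c : PPoint k l, (Sum.elim (φ ∘ f ∘ Sum.inl) (ψ ∘ g) :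
            Fin k ⊕ (Fin l ⊕ Fin m) → γ) (Sum.map id Sum.inl c) = φ (f c) := by
          rintro (c | c)
          · rfl
          · exact (hmid c).symm
        rw [Setoid.ker_def, hv, hv, (hf a b).1 hab]
      · rw [Setoid.ker_def]
        simp [(hg a b).1 hab]
    have := key h
    rw [Setoid.ker_def] at this
    rcases x with x | x <;> rcases y with y | y <;> exact this
  · intro h
    classical
    -- The glued classes themselves are the test labels; `Option` supplies a default value for
    -- labels that `f` or `g` does not attain.
    let Q := Quotient (glued p q)
    let P₁ : PPoint k l → Option Q := fun a => some (Quotient.mk _ (Sum.map id Sum.inl a))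
    let P₂ : PPoint l m → Option Q := fun a => some (Quotient.mk _ (Sum.inr a))
    have h₁ : Function.FactorsThrough P₁ f := fun a b hab =>
      congrArg some (Quotient.sound (Relation.EqvGen.rel _ _
        (Or.inl ⟨a, b, (hf a b).2 hab, rfl, rfl⟩)))
    have h₂ : Function.FactorsThrough P₂ g := fun a b hab =>
      congrArg some (Quotient.sound (Relation.EqvGen.rel _ _
        (Or.inr ⟨a, b, (hg a b).2 hab, rfl, rfl⟩)))
    have := hc (Option Q) (Function.extend f P₁ fun _ => none) (Function.extend g P₂ fun _ => none)
      (fun i => by rw [h₁.extend_apply, h₂.extend_apply]; rfl) x y h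
    have e : ∀ z : PPoint k m, Sum.elim ((Function.extend f P₁ fun _ => none) ∘ f ∘ Sum.inl)
        ((Function.extend g P₂ fun _ => none) ∘ g ∘ Sum.inr) z =
        some (Quotient.mk (glued p q) (Sum.map id Sum.inr z)) := by
      rintro (z | z)
      · simp only [Sum.elim_inl, Function.comp]
        rw [h₁.extend_apply]; rfl
      · simp only [Sum.elim_inr, Function.comp]
        rw [h₂.extend_apply]; rfl
    rw [e, e] at this
    exact Quotient.exact (s := glued p q) (Option.some.inj this)

end TCPartition

/-! ### Partitions of a category represented by pairs of words -/

namespace TCPartitionSet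

open TCPartition

variable {C : TCPartitionSet} {α β γ : Type}

/-- Some partition of `C` has the upper word `u` and the lower word `v`. -/
def Rep (C : TCPartitionSet) (u v : LWord α) : Prop :=
  ∃ (k l : ℕ) (p : TCPartition k l) (f : PPoint k l → α), p ∈ C k l ∧
    (∀ x y, p.rel x y ↔ f x = f y) ∧ p.upperWord f = u ∧ p.lowerWord f = v

theorem Rep.relabel {u v : LWord α} (h : C.Rep u v) (φ : α → β)
    (hφ : ∀ x ∈ u ++ v, ∀ y ∈ u ++ v, φ x.2 = φ y.2 → x.2 = y.2) :
    C.Rep (lmap φ u) (lmap φ v) := by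
  obtain ⟨k, l, p, f, hp, hf, rfl, rfl⟩ := h
  refine ⟨k, l, p, φ ∘ f, hp, fun x y => ?_, ?_, ?_⟩
  · rw [hf]
    refine ⟨fun h => congrArg φ h, fun h => ?_⟩
    have hm : ∀ z, ∃ c, (c, f z) ∈ p.upperWord f ++ p.lowerWord f := by
      rintro (z | z)
      · exact ⟨p.upper z, List.mem_append_left _ (List.mem_ofFn.2 ⟨z, rfl⟩)⟩
      · exact ⟨p.lower z, List.mem_append_right _ (List.mem_ofFn.2 ⟨z, rfl⟩)⟩
    obtain ⟨c, hc⟩ := hm x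
    obtain ⟨d, hd⟩ := hm y
    exact hφ _ hc _ hd h
  · simp [upperWord, lmap, List.map_ofFn, Function.comp_def]
  · simp [lowerWord, lmap, List.map_ofFn, Function.comp_def]

theorem Rep.star (hC : C.IsCategory) {u v : LWord α} (h : C.Rep u v) : C.Rep v u := by
  obtain ⟨k, l, p, f, hp, hf, rfl, rfl⟩ := h
  exact ⟨l, k, p.star, f ∘ Sum.swap, hC.star_mem p hp, fun x y => hf _ _, rfl, rfl⟩

theorem Rep.tensor (hC : C.IsCategory) {u v : LWord α} {u' v' : LWord β} (h : C.Rep u v)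
    (h' : C.Rep u' v') : C.Rep (lmap (Sum.inl : α → α ⊕ β) u ++ lmap Sum.inr u')
      (lmap (Sum.inl : α → α ⊕ β) v ++ lmap Sum.inr v') := by
  obtain ⟨k, l, p, f, hp, hf, rfl, rfl⟩ := h
  obtain ⟨k', l', q, g, hq, hg, rfl, rfl⟩ := h'
  refine ⟨_, _, p.tensor q, Sum.map f g ∘ splitPoints k k' l l', hC.tensor_mem p q hp hq,
    fun x y => ?_, ?_, ?_⟩
  · change Sum.LiftRel p.rel q.rel _ _ ↔ Sum.map f g (splitPoints k k' l l' x) =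
      Sum.map f g (splitPoints k k' l l' y)
    generalize splitPoints k k' l l' x = x
    generalize splitPoints k k' l l' y = y
    rcases x with x | x <;> rcases y with y | y <;> simp [hf, hg]
  · simp only [upperWord, lmap, List.map_ofFn, ← List.ofFn_fin_append]
    congr 1
    funext i
    refine Fin.addCases (fun i => ?_) (fun i => ?_) i <;>
      simp [TCPartition.tensor, splitPoints]
  · simp only [lowerWord, lmap, List.map_ofFn, ← List.ofFn_fin_append]
    congr 1
    funext i
    refine Fin.addCases (fun i => ?_) (fun i => ?_) i <;>
      simp [TCPartition.tensor, splitPoints]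

theorem Rep.comp (hC : C.IsCategory) {v : LWord α} {v' w : LWord β} (h : C.Rep [] v)
    (h' : C.Rep v' w) (φ : α → γ) (ψ : β → γ) (hmid : lmap φ v = lmap ψ v')
    (hc : ∀ (T : Type) (F : α → T) (G : β → T), lmap F v = lmap G v' →
      ∀ x ∈ w, ∀ y ∈ w, ψ x.2 = ψ y.2 → G x.2 = G y.2) : C.Rep [] (lmap ψ w) := by
  obtain ⟨k, l, p, f, hp, hf, hk, rfl⟩ := h
  obtain ⟨l', m, q, g, hq, hg, rfl, rfl⟩ := h'
  obtain rfl : k = 0 := by simpa [upperWord] using congrArg List.length hk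
  obtain rfl : l = l' := by
    simpa [upperWord, lowerWord, lmap] using congrArg List.length hmid
  have key : ∀ (T : Type) (F : α → T) (G : β → T),
      lmap F (p.lowerWord f) = lmap G (q.upperWord g) ↔
        ∀ i, p.lower i = q.upper i ∧ F (f (Sum.inr i)) = G (g (Sum.inl i)) := by
    intro T F G
    simp only [lmap, lowerWord, upperWord, List.map_ofFn, List.ofFn_inj, funext_iff,
      Function.comp, Prod.map, id, Prod.mk.injEq]
  have hm := (key _ _ _).1 hmid
  refine ⟨0, m, p.comp q, Sum.elim (φ ∘ f ∘ Sum.inl) (ψ ∘ g ∘ Sum.inr),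
    hC.comp_mem p q hp hq (funext fun i => (hm i).1),
    comp_rel_iff p q f g hf hg φ ψ (fun i => (hm i).2) ?_, by simp [upperWord], ?_⟩
  · intro T F G hFG x y hxy
    rcases x with x | x
    · exact x.elim0
    rcases y with y | y
    · exact y.elim0
    exact hc T F G ((key _ _ _).2 fun i => ⟨(hm i).1, hFG i⟩)
      (q.lower x, g (Sum.inr x)) (List.mem_ofFn.2 ⟨x, rfl⟩)
      (q.lower y, g (Sum.inr y)) (List.mem_ofFn.2 ⟨y, rfl⟩) hxy
  · simp [lowerWord, lmap, List.map_ofFn, Function.comp_def, TCPartition.comp]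

/-- The empty partition is not among the generators; it arises as a lower pair capped by its own
reflection. -/
theorem Rep.nil (hC : C.IsCategory) : C.Rep ([] : LWord α) [] := by
  refine ⟨0, 0, _, fun x => x.elim Fin.elim0 Fin.elim0,
    hC.comp_mem _ _ (hC.lowerPair_mem .white) (hC.star_mem _ (hC.lowerPair_mem .white)) rfl,
    ?_, rfl, rfl⟩
  rintro (x | x) <;> exact x.elim0

theorem Rep.single (hC : C.IsCategory) (x : PColor × α) : C.Rep [x] [x] :=
  ⟨1, 1, _, fun _ => x.2, hC.ident_mem x.1, fun _ _ => ⟨fun _ => rfl, fun _ => trivial⟩, rfl, rfl⟩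

theorem Rep.pair (hC : C.IsCategory) (c : PColor) (a : α) : C.Rep [] [(c, a), (c.inv, a)] :=
  ⟨0, 2, _, fun _ => a, hC.lowerPair_mem c, fun _ _ => ⟨fun _ => rfl, fun _ => trivial⟩, rfl, rfl⟩

/-- These parallel through-strands, each its own block, leave a part of a word untouched under
composition. -/
theorem Rep.ofFn_id (hC : C.IsCategory) {n : ℕ} (c : Fin n → PColor) :
    C.Rep (List.ofFn fun i => (c i, i)) (List.ofFn fun i => (c i, i)) := by
  induction n with
  | zero => exact Rep.nil hC
  | succ n ih =>
    have h := ((Rep.single hC (c 0, ())).tensor hC (ih fun i => c i.succ)).relabel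
      (Sum.elim (fun _ => (0 : Fin (n + 1))) Fin.succ) (by
        rintro ⟨_, x | x⟩ - ⟨_, y | y⟩ - h
        · rfl
        · exact absurd h.symm (Fin.succ_ne_zero _)
        · exact absurd h (Fin.succ_ne_zero _)
        · simpa using h)
    have e : lmap (Sum.elim (fun _ => (0 : Fin (n + 1))) Fin.succ)
        (lmap (Sum.inl : Unit → Unit ⊕ Fin n) [(c 0, ())] ++
          lmap Sum.inr (List.ofFn fun i : Fin n => (c i.succ, i))) =
        List.ofFn fun i => (c i, i) := by
      rw [List.ofFn_succ]
      simp [lmap, List.map_ofFn, Function.comp_def]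
    rwa [e] at h

end TCPartitionSet

/-! ### Local operations on words -/

namespace LWord

variable {α β : Type}

/-- The colors of a word, the positions being used as labels. -/
def positions (u : LWord α) : LWord (Fin u.length) := List.ofFn fun i => ((u.get i).1, i)

theorem lmap_positions (F : α → β) (u : LWord α) :
    lmap (fun i => F (u.get i).2) u.positions = lmap F u := by
  have h : lmap F u = lmap F (List.ofFn u.get) := by rw [List.ofFn_get]
  rw [h, positions, lmap, lmap, List.map_ofFn, List.map_ofFn]
  rfl

theorem eq_of_lmap_eq_lmap_positions {F : α → β} {u : LWord α} {G : Fin u.length → β}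
    (h : lmap F u = lmap G u.positions) (i : Fin u.length) : F (u.get i).2 = G i := by
  rw [← lmap_positions] at h
  exact eq_of_lmap_eq h ((u.get i).1, i) (List.mem_ofFn.2 ⟨i, rfl⟩)

@[simp] theorem length_lmap (φ : α → β) (w : LWord α) : (lmap φ w).length = w.length := by
  simp [lmap]

@[simp] theorem length_positions (w : LWord α) : w.positions.length = w.length := by
  simp [positions]

@[simp] theorem length_bar (w : LWord α) : (bar w).length = w.length := by
  simp [bar]

end LWord

namespace TCPartitionSet

open TCPartition

variable {C : TCPartitionSet} {α β γ : Type}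

/-- Composing with the given partition flanked by identity strands rewrites only the segment `t`.
The condition `hc` is again the universal property of the gluing, split by where the two compared
labels lie. -/
theorem Rep.context (hC : C.IsCategory) {u t v : LWord α} {t' q : LWord β}
    (h : C.Rep [] (u ++ (t ++ v))) (h' : C.Rep t' q) (φ : α → γ) (ψ : β → γ)
    (hmid : lmap φ t = lmap ψ t')
    (hc : ∀ (T : Type) (F : α → T) (G : β → T), lmap F t = lmap G t' →
      (∀ x ∈ u ++ v, ∀ y ∈ u ++ v, φ x.2 = φ y.2 → F x.2 = F y.2) ∧
      (∀ x ∈ u ++ v, ∀ y ∈ q, φ x.2 = ψ y.2 → F x.2 = G y.2) ∧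
      (∀ x ∈ q, ∀ y ∈ q, ψ x.2 = ψ y.2 → G x.2 = G y.2)) :
    C.Rep [] (lmap φ u ++ (lmap ψ q ++ lmap φ v)) := by
  -- Positions serve as labels on the strands, so that distinct strands are distinct blocks even
  -- where `u` or `v` repeats a label.
  have hr := (Rep.ofFn_id hC fun i => (u.get i).1).tensor hC
    (h'.tensor hC (Rep.ofFn_id hC fun i => (v.get i).1))
  have hlen : t.length = t'.length := by simpa using congrArg List.length hmid
  have key := h.comp hC hr φ
    (Sum.elim (fun i => φ (u.get i).2) (Sum.elim ψ fun i => φ (v.get i).2)) ?_ ?_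
  · convert key using 1
    simp only [lmap_append, lmap_lmap]
    congr 1
    · exact (lmap_positions φ u).symm
    · congr 1
      exact (lmap_positions φ v).symm
  · simp only [lmap_append, lmap_lmap]
    congr 1
    · exact (lmap_positions φ u).symm
    · congr 1
      exact (lmap_positions φ v).symm
  · intro T F G hFG
    simp only [lmap_append, lmap_lmap] at hFG
    obtain ⟨hu, hFG⟩ := List.append_inj hFG (by simp)
    obtain ⟨ht, hv⟩ := List.append_inj hFG (by simp [hlen])
    have hu' := eq_of_lmap_eq_lmap_positions (u := u) hu
    have hv' := eq_of_lmap_eq_lmap_positions (u := v) hv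
    obtain ⟨h₁, h₂, h₃⟩ := hc T F _ ht
    have hmem : ∀ x ∈ lmap (Sum.inl : _ → Fin u.length ⊕ (β ⊕ Fin v.length)) u.positions ++
        lmap Sum.inr (lmap Sum.inl q ++ lmap Sum.inr v.positions),
        (∃ z ∈ u ++ v, Sum.elim (fun i => φ (u.get i).2)
            (Sum.elim ψ fun i => φ (v.get i).2) x.2 = φ z.2 ∧ G x.2 = F z.2) ∨
          (∃ z ∈ q, x.2 = Sum.inr (Sum.inl z.2)) := by
      rintro ⟨c, i | b | i⟩ hx
      · exact Or.inl ⟨u.get i, List.mem_append_left _ (List.get_mem _ _), rfl, (hu' i).symm⟩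
      · right
        have : (c, b) ∈ q := by simpa [lmap, Prod.map, positions] using hx
        exact ⟨_, this, rfl⟩
      · exact Or.inl ⟨v.get i, List.mem_append_right _ (List.get_mem _ _), rfl, (hv' i).symm⟩
    intro x hx y hy hxy
    rcases hmem x hx with ⟨z, hz, e₁, e₂⟩ | ⟨z, hz, e⟩ <;>
      rcases hmem y hy with ⟨z', hz', e₁', e₂'⟩ | ⟨z', hz', e'⟩
    · rw [e₂, e₂']
      exact h₁ z hz z' hz' (by rw [← e₁, ← e₁', hxy])
    · rw [e₂, e']
      exact h₂ z hz z' hz' (by rw [← e₁, hxy, e']; rfl)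
    · rw [e, e₂']
      exact (h₂ z' hz' z hz (by rw [← e₁', ← hxy, e]; rfl)).symm
    · rw [e, e'] at hxy ⊢
      exact h₃ z hz z' hz' hxy

/-- Some partition of `C` without upper points has the lower word `w`. -/
def Word (C : TCPartitionSet) (w : LWord α) : Prop := C.Rep [] w

theorem Word.relabel {w : LWord α} (h : C.Word w) (φ : α → β)
    (hφ : ∀ x ∈ labels w, ∀ y ∈ labels w, φ x = φ y → x = y) : C.Word (lmap φ w) :=
  Rep.relabel h φ fun _ hx _ hy => hφ _ (mem_labels_of_mem hx) _ (mem_labels_of_mem hy)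

theorem Word.insert (hC : C.IsCategory) {u v : LWord α} {q : LWord β} (h : C.Word (u ++ v))
    (hq : C.Word q) :
    C.Word (lmap (Sum.inl : α → α ⊕ β) u ++ (lmap Sum.inr q ++ lmap Sum.inl v)) := by
  refine Rep.context (t := []) (t' := []) hC h hq Sum.inl Sum.inr rfl fun T F G _ => ?_
  refine ⟨fun x _ y _ e => ?_, fun x _ y _ e => ?_, fun x _ y _ e => ?_⟩
  · rw [Sum.inl.inj e]
  · cases e
  · rw [Sum.inr.inj e]

theorem Word.append (hC : C.IsCategory) {u : LWord α} {v : LWord β} (hu : C.Word u)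
    (hv : C.Word v) : C.Word (lmap (Sum.inl : α → α ⊕ β) u ++ lmap Sum.inr v) := by
  have := Word.insert (v := []) hC (by simpa using hu) hv
  simpa using this

/-- Two neighboring points of inverse colors may be erased, their blocks being joined. -/
theorem Word.erase (hC : C.IsCategory) {u v : LWord α} {c : PColor} {a b : α}
    (h : C.Word (u ++ (c, a) :: (c.inv, b) :: v)) (φ : α → β) (hab : φ a = φ b)
    (hφ : ∀ x y, φ x = φ y → x = y ∨ (x = a ∨ x = b) ∧ (y = a ∨ y = b)) :
    C.Word (lmap φ (u ++ v)) := by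
  have := Rep.context (t := [(c, a), (c.inv, b)]) (t' := [(c, ()), (c.inv, ())]) (q := []) hC h
    (Rep.star hC (Rep.pair hC c ())) φ (fun _ => φ a) (by simp [hab]) fun T F G hFG => ?_
  · rw [lmap_append]
    exact this
  · have h₁ : F a = G () ∧ F b = G () := by simpa using hFG
    refine ⟨fun x _ y _ e => ?_, fun x _ y hy => by simp at hy, fun x hx => by simp at hx⟩
    rcases hφ _ _ e with e | ⟨e | e, e' | e'⟩ <;> rw [e] <;> simp [e', h₁]

/-- Enclose the word in a pair colored `c.inv`, `c` and erase the left leg against the first letter: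
the right leg takes over that letter's role at the end. -/
theorem Word.rotate_one (hC : C.IsCategory) {x : PColor × α} {v : LWord α}
    (h : C.Word (x :: v)) : C.Word (v ++ [x]) := by
  obtain ⟨c, a⟩ := x
  have h₁ : C.Word [(c.inv, ()), (c, ())] := by
    have := Rep.pair hC c.inv ()
    rwa [PColor.inv_inv] at this
  have h₂ := Word.insert (u := [(c.inv, ())]) (v := [(c, ())]) hC h₁ h
  have h₃ := Word.erase (u := []) (c := c.inv) (a := Sum.inl ()) (b := Sum.inr a)
    (v := lmap Sum.inr v ++ [(c, Sum.inl ())]) (β := α) hC (by simpa using h₂)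
    (Sum.elim (fun _ => a) id) rfl ?_
  · simpa using h₃
  · rintro (x | x) (y | y) e
    · exact Or.inl rfl
    · simp at e; simp [e]
    · simp at e; simp [e]
    · simp at e; simp [e]

theorem Word.rotate (hC : C.IsCategory) {u v : LWord α} (h : C.Word (u ++ v)) :
    C.Word (v ++ u) := by
  induction u generalizing v with
  | nil => simpa using h
  | cons x u ih =>
    have := ih (v := v ++ [x]) (by simpa using Word.rotate_one hC h)
    simpa using this

/-- The rainbow of nested pairs is the device for bending an upper row down. -/
theorem Word.nested (hC : C.IsCategory) {u : LWord α} (hu : (labels u).Nodup) :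
    C.Word (u ++ bar u) := by
  induction u with
  | nil => exact Rep.nil hC
  | cons x u ih =>
    obtain ⟨c, a⟩ := x
    rw [labels_cons, List.nodup_cons] at hu
    have h := (Word.insert (u := [(c, ())]) (v := [(c.inv, ())]) hC (Rep.pair hC c ())
      (ih hu.2)).relabel (Sum.elim (fun _ => a) id) ?_
    · simpa using h
    · have hx : ∀ x : α, (Sum.inr x : Unit ⊕ α) ∈ labels (lmap (Sum.inl : Unit → Unit ⊕ α)
          [(c, ())] ++ (lmap Sum.inr (u ++ bar u) ++ lmap Sum.inl [(c.inv, ())])) → x ≠ a := by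
        intro x hx e
        subst e
        apply hu.1
        simpa using hx
      rintro (x | x) hx' (y | y) hy' e
      · rfl
      · exact absurd e.symm (hx y hy')
      · exact absurd e (hx x hx')
      · exact congrArg Sum.inr e

/-- Apply the partition to the left half of a rainbow over `u`: that half becomes `v`, while the
right half remains as `bar u`. -/
theorem Rep.word (hC : C.IsCategory) {u v : LWord α} (h : C.Rep u v) : C.Word (v ++ bar u) := by
  have hn : (labels u.positions).Nodup := by
    simp [positions, labels, List.map_ofFn, Function.comp_def, List.nodup_ofFn,
      Function.Injective]
  have := Rep.context (u := []) hC (Word.nested hC hn) h (fun i => (u.get i).2) id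
    (by rw [lmap_id]; exact (lmap_positions id u).trans (lmap_id u)) fun T F G hFG => ?_
  · have e := lmap_positions id u
    simp only [id, lmap_id] at e
    rw [lmap_nil, List.nil_append, lmap_id, ← bar_lmap] at this
    have e' : lmap (fun i => (u.get i).2) u.positions = u := by
      simpa [lmap_id] using e
    rw [e'] at this
    exact this
  · have hG := eq_of_lmap_eq_lmap_positions (u := u) (F := G) hFG.symm
    refine ⟨fun x _ y _ e => ?_, fun x _ y _ e => ?_, fun x _ y _ e => congrArg G e⟩
    · rw [← hG, ← hG, e]
    · rw [← hG, e]; rfl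

theorem Word.reflect (hC : C.IsCategory) {w : LWord α} (h : C.Word w) : C.Word (bar w) :=
  Rep.word hC (Rep.star hC h)

/-- Two words can be glued along points of inverse colors, the two blocks being joined. -/
theorem Word.join (hC : C.IsCategory) {u : LWord α} {v : LWord β} {c : PColor} {a : α} {b : β}
    (hu : C.Word (u ++ [(c, a)])) (hv : C.Word ((c.inv, b) :: v)) :
    ∃ g : β → α ⊕ β, Function.Injective g ∧ g b = Sum.inl a ∧
      (∀ x y, g y = Sum.inl x → x = a ∧ y = b) ∧ C.Word (lmap Sum.inl u ++ lmap g v) := by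
  classical
  have h := Word.append hC hu hv
  refine ⟨fun y => if y = b then Sum.inl a else Sum.inr y, ?_, by simp, ?_, ?_⟩
  · intro x y e
    by_cases hx : x = b <;> by_cases hy : y = b <;> simp_all
  · intro x y e
    by_cases hy : y = b <;> simp_all
  · have := Word.erase (u := lmap Sum.inl u) (c := c) (a := Sum.inl a) (b := Sum.inr b)
      (v := lmap Sum.inr v) (β := α ⊕ β) hC (by simpa using h)
      (Sum.elim Sum.inl fun y => if y = b then Sum.inl a else Sum.inr y) (by simp) ?_
    · simpa [Function.comp_def] using this
    · rintro (x | x) (y | y) e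
      · left; simpa using e
      · by_cases hy : y = b <;> simp_all
      · by_cases hy : x = b <;> simp_all
      · by_cases hx : x = b <;> by_cases hy : y = b <;> simp_all

/-- Gluing a word with its reflection along a segment. -/
theorem Word.fold (hC : C.IsCategory) {u v : LWord α} (h : C.Word (u ++ v)) :
    ∃ g : α → α ⊕ α, (∀ x ∈ labels v, g x = Sum.inl x) ∧
      C.Word (lmap Sum.inl u ++ lmap g (bar u)) := by
  classical
  -- Start from the word followed by its reflection and erase `v` against its mirror image from the
  -- center outwards; `v₂` is the part already erased, whose labels are identified in both copies.
  suffices H : ∀ v₁ v₂ : LWord α, v = v₁ ++ v₂ →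
      C.Word (lmap Sum.inl (u ++ v₁) ++
        lmap (fun x => if x ∈ labels v₂ then Sum.inl x else Sum.inr x) (bar (u ++ v₁))) by
    refine ⟨fun x => if x ∈ labels v then Sum.inl x else Sum.inr x, fun x hx => by simp [hx], ?_⟩
    simpa using H [] v rfl
  intro v₁ v₂ hv
  induction v₂ generalizing v₁ with
  | nil =>
    obtain rfl : v = v₁ := by simpa using hv
    simpa using Word.append hC h (Word.reflect hC h)
  | cons x v₂ ih =>
    obtain ⟨c, a⟩ := x
    have h₁ := ih (v₁ ++ [(c, a)]) (by simpa using hv)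
    obtain ⟨b, hb⟩ : ∃ b, b = if a ∈ labels v₂ then Sum.inl a else (Sum.inr a : α ⊕ α) := ⟨_, rfl⟩
    have h₂ := Word.erase (u := lmap Sum.inl (u ++ v₁)) (c := c) (a := Sum.inl a) (b := b)
      (β := α ⊕ α)
      (v := lmap (fun x => if x ∈ labels v₂ then Sum.inl x else Sum.inr x) (bar (u ++ v₁)))
      hC (by simpa [hb] using h₁) (fun z => if z = b then Sum.inl a else z) ?_ ?_
    · rw [lmap_append, lmap_lmap, lmap_lmap] at h₂
      convert h₂ using 3
      · funext x
        by_cases ha : a ∈ labels v₂ <;> simp [hb, ha]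
      · funext x
        by_cases hx : x = a <;> by_cases hx' : x ∈ labels v₂ <;> by_cases ha : a ∈ labels v₂ <;>
          simp_all
    · simp
    · intro x y e
      by_cases hx : x = b <;> by_cases hy : y = b <;> simp_all

end TCPartitionSet

/-! ### Color offsets and crossings in words -/

namespace PColor

/-- The correction term relating the color distance of two points with colors `c₁` and `c₂` to the
color sum of the open interval between them. -/
def offset : PColor → PColor → ℤ
  | white, white => 1
  | black, black => -1
  | _, _ => 0

/-- All offset identities reflect `offset c₁ c₂ = (c₁.sign + c₂.sign) / 2`. This one serves when the
intermediate points are erased, `offset_add` when the intermediate point stays. -/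
theorem offset_add_inv (c₁ c c₂ : PColor) :
    offset c₁ c + offset c.inv c₂ = offset c₁ c₂ := by
  cases c₁ <;> cases c <;> cases c₂ <;> rfl

theorem offset_add (c₁ c c₂ : PColor) :
    offset c₁ c + offset c c₂ = c.sign + offset c₁ c₂ := by
  cases c₁ <;> cases c <;> cases c₂ <;> rfl

theorem offset_inv_inv (c₁ c₂ : PColor) : offset c₂.inv c₁.inv = -offset c₁ c₂ := by
  cases c₁ <;> cases c₂ <;> rfl

theorem offset_comm_add (c₁ c₂ : PColor) :
    offset c₁ c₂ + offset c₂ c₁ = c₁.sign + c₂.sign := by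
  cases c₁ <;> cases c₂ <;> rfl

@[simp] theorem offset_inv (c : PColor) : offset c c.inv = 0 := by cases c <;> rfl

theorem eq_or_eq_inv (c d : PColor) : c = d ∨ c = d.inv := by
  cases c <;> cases d <;> simp [inv]

end PColor

open PColor

namespace LWord

variable {α β : Type}

theorem exists_split_first {a : α} {w : LWord α} (h : a ∈ labels w) :
    ∃ c u v, w = u ++ (c, a) :: v ∧ a ∉ labels u := by
  induction w with
  | nil => simp at h
  | cons x w ih =>
    by_cases hx : x.2 = a
    · exact ⟨x.1, [], w, by simp [← hx], by simp⟩
    · have : a ∈ labels w := by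
        rw [labels_cons, List.mem_cons] at h
        exact h.resolve_left fun e => hx e.symm
      obtain ⟨c, u, v, rfl, hu⟩ := ih this
      exact ⟨c, x :: u, v, rfl, by simp [hu, Ne.symm hx]⟩

theorem exists_split_last {a : α} {w : LWord α} (h : a ∈ labels w) :
    ∃ c u v, w = u ++ (c, a) :: v ∧ a ∉ labels v := by
  obtain ⟨c, u, v, e, hu⟩ := exists_split_first (w := bar w) (by simpa using h)
  refine ⟨c.inv, bar v, bar u, ?_, by simpa using hu⟩
  rw [← bar_bar w, e]
  simp

/-- Two labels alternate in a cyclic list of labels. -/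
def Crossing (a b : α) (l : List α) : Prop :=
  List.Sublist [a, b, a, b] l ∨ List.Sublist [b, a, b, a] l

theorem Crossing.mono {a b : α} {l l' : List α} (h : Crossing a b l) (hl : List.Sublist l l') :
    Crossing a b l' :=
  h.imp (fun h => h.trans hl) fun h => h.trans hl

theorem Crossing.symm {a b : α} {l : List α} (h : Crossing a b l) : Crossing b a l := Or.symm h

theorem Crossing.map {a b : α} {l : List α} (h : Crossing a b l) (g : α → β) :
    Crossing (g a) (g b) (l.map g) :=
  h.imp (fun h => h.map g) fun h => h.map g

theorem Crossing.reverse {a b : α} {l : List α} (h : Crossing a b l) : Crossing a b l.reverse :=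
  (h.imp (fun h => h.reverse) fun h => h.reverse).symm

theorem Crossing.rotate {a b : α} {l l' : List α} (h : Crossing a b (l ++ l')) :
    Crossing a b (l' ++ l) := by
  induction l generalizing l' with
  | nil => simpa using h
  | cons x l ih =>
    have : Crossing a b (l ++ (l' ++ [x])) := by
      -- If the moved letter starts the pattern, `abab` becomes `baba`; hence `Crossing` allows
      -- both.
      have aux : ∀ a b : α, List.Sublist [a, b, a, b] (x :: (l ++ l')) →
          Crossing a b (l ++ l' ++ [x]) := by
        intro a b h
        rcases List.sublist_cons_iff.1 h with h | ⟨r, e, h⟩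
        · exact Or.inl (h.trans (List.sublist_append_left _ _))
        · obtain ⟨rfl, rfl⟩ := List.cons.inj e
          exact Or.inr (h.append (List.Sublist.refl [a]))
      rw [← List.append_assoc]
      rcases h with h | h
      · exact aux a b h
      · exact (aux b a h).symm
    simpa using ih this

end LWord

/-! ### Arithmetic of the invariants on words -/

namespace TCPartitionSet

open TCPartition

/-- The color sums of the words of `C`. -/
def wordSig (C : TCPartitionSet) : Set ℤ :=
  {z | ∃ (α : Type) (w : LWord α), C.Word w ∧ z = csum w}

/-- The color distances between subsequent legs of one block with prescribed colors. -/
def wordK (C : TCPartitionSet) (c₁ c₂ : PColor) : Set ℤ :=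
  {z | ∃ (α : Type) (a : α) (u v : LWord α), C.Word ((c₁, a) :: (u ++ (c₂, a) :: v)) ∧
    a ∉ labels u ∧ z = csum u + offset c₁ c₂}

/-- The color distances between legs of crossing blocks with prescribed colors. -/
def wordX (C : TCPartitionSet) (c₁ c₂ : PColor) : Set ℤ :=
  {z | ∃ (α : Type) (a b : α) (u v : LWord α), C.Word ((c₁, a) :: (u ++ (c₂, b) :: v)) ∧
    a ≠ b ∧ Crossing a b (labels ((c₁, a) :: (u ++ (c₂, b) :: v))) ∧
    z = csum u + offset c₁ c₂}

variable {C : TCPartitionSet} {α β γ : Type} {c₁ c c₂ : PColor} {y z : ℤ}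

theorem add_mem_wordSig (hC : C.IsCategory) (hy : y ∈ C.wordSig) (hz : z ∈ C.wordSig) :
    y + z ∈ C.wordSig := by
  obtain ⟨α, u, hu, rfl⟩ := hy
  obtain ⟨β, v, hv, rfl⟩ := hz
  exact ⟨_, _, Word.append hC hu hv, by simp⟩

theorem neg_mem_wordSig (hC : C.IsCategory) (hz : z ∈ C.wordSig) : -z ∈ C.wordSig := by
  obtain ⟨α, u, hu, rfl⟩ := hz
  exact ⟨_, _, Word.reflect hC hu, by simp⟩

theorem zero_mem_wordSig (hC : C.IsCategory) : (0 : ℤ) ∈ C.wordSig :=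
  ⟨Unit, [], Rep.nil hC, rfl⟩

theorem wordSig_subset_wordK (hC : C.IsCategory) (c : PColor) :
    C.wordSig ⊆ C.wordK c c.inv := by
  rintro _ ⟨α, w, hw, rfl⟩
  have := Word.insert (u := [(c, ())]) (v := [(c.inv, ())]) hC (Rep.pair hC c ()) hw
  refine ⟨Unit ⊕ α, Sum.inl (), lmap Sum.inr w, [], by simpa using this, by simp, by simp⟩

/-- Glue the second leg of the first word to the first leg of the second. Both vanish, their blocks
merge, and the two open intervals become adjacent. -/
theorem add_mem_wordK (hC : C.IsCategory) (hy : y ∈ C.wordK c₁ c) (hz : z ∈ C.wordK c.inv c₂) :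
    y + z ∈ C.wordK c₁ c₂ := by
  obtain ⟨α, a, u, v, h, hu, rfl⟩ := hy
  obtain ⟨β, b, u', v', h', hu', rfl⟩ := hz
  obtain ⟨g, hg, hgb, -, hw⟩ := Word.join hC (u := v ++ (c₁, a) :: u) (c := c) (a := a)
    (by simpa using Word.rotate (u := (c₁, a) :: u ++ [(c, a)]) hC (by simpa using h)) h'
  have hr := Word.rotate (u := lmap Sum.inl v) hC (by simpa using hw)
  refine ⟨α ⊕ β, Sum.inl a, lmap Sum.inl u ++ lmap g u', lmap g v' ++ lmap Sum.inl v,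
    by simpa [hgb] using hr, ?_, ?_⟩
  · simp only [labels_append, labels_lmap, List.mem_append, List.mem_map, not_or, not_exists,
      not_and]
    refine ⟨fun x hx e => hu (by rwa [← Sum.inl.inj e]), fun x hx e => hu' ?_⟩
    rwa [← hg (e.trans hgb.symm)]
  · rw [csum_append, csum_lmap, csum_lmap, ← offset_add_inv c₁ c c₂]
    ring

/-- The same gluing preserves the crossing: the leg of color `c₁` replaces the erased first leg, so
the label sequence of the second word survives as a sublist. -/
theorem add_mem_wordX (hC : C.IsCategory) (hy : y ∈ C.wordK c₁ c) (hz : z ∈ C.wordX c.inv c₂) :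
    y + z ∈ C.wordX c₁ c₂ := by
  obtain ⟨α, a, u, v, h, hu, rfl⟩ := hy
  obtain ⟨β, b, d, u', v', h', hbd, hX, rfl⟩ := hz
  obtain ⟨g, hg, hgb, -, hw⟩ := Word.join hC (u := v ++ (c₁, a) :: u) (c := c) (a := a)
    (by simpa using Word.rotate (u := (c₁, a) :: u ++ [(c, a)]) hC (by simpa using h)) h'
  have hr := Word.rotate (u := lmap Sum.inl v) hC (by simpa using hw)
  refine ⟨α ⊕ β, Sum.inl a, g d, lmap Sum.inl u ++ lmap g u', lmap g v' ++ lmap Sum.inl v,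
    by simpa [hgb] using hr, fun e => hbd (hg (hgb.trans e)), ?_, ?_⟩
  · have := hX.map g
    rw [hgb] at this
    refine this.mono ?_
    simp only [labels_cons, labels_append, labels_lmap, List.map_cons, List.map_append, hgb]
    refine List.Sublist.cons_cons _ ?_
    rw [List.append_assoc]
    refine List.Sublist.trans ?_ (List.sublist_append_right _ _)
    refine List.Sublist.append_left (List.Sublist.cons_cons _ ?_) _
    exact List.sublist_append_left _ _
  · rw [csum_append, csum_lmap, csum_lmap, ← offset_add_inv c₁ c c₂]
    ring

theorem neg_mem_wordK (hC : C.IsCategory) (hz : z ∈ C.wordK c₁ c₂) :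
    -z ∈ C.wordK c₂.inv c₁.inv := by
  obtain ⟨α, a, u, v, h, hu, rfl⟩ := hz
  have := Word.rotate (u := bar v) (v := (c₂.inv, a) :: (bar u ++ [(c₁.inv, a)])) hC
    (by simpa using Word.reflect hC h)
  exact ⟨α, a, bar u, bar v, by simpa using this, by simpa using hu,
    by rw [csum_bar, offset_inv_inv]; ring⟩

theorem neg_mem_wordX (hC : C.IsCategory) (hz : z ∈ C.wordX c₁ c₂) :
    -z ∈ C.wordX c₂.inv c₁.inv := by
  obtain ⟨α, a, b, u, v, h, hab, hX, rfl⟩ := hz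
  have := Word.rotate (u := bar v) (v := (c₂.inv, b) :: (bar u ++ [(c₁.inv, a)])) hC
    (by simpa using Word.reflect hC h)
  have hX' := Crossing.rotate (l := labels (bar v))
    (l' := labels ((c₂.inv, b) :: (bar u ++ [(c₁.inv, a)]))) (by simpa using hX.reverse)
  exact ⟨α, b, a, bar u, bar v, by simpa using this, hab.symm, by simpa using hX'.symm,
    by rw [csum_bar, offset_inv_inv]; ring⟩

theorem add_wordSig_mem_wordK (hC : C.IsCategory) (hy : y ∈ C.wordSig)
    (hz : z ∈ C.wordK c₁ c₂) : y + z ∈ C.wordK c₁ c₂ := by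
  have := wordSig_subset_wordK hC c₁ hy
  exact add_mem_wordK hC this (by rwa [PColor.inv_inv])

theorem add_wordSig_mem_wordX (hC : C.IsCategory) (hy : y ∈ C.wordSig)
    (hz : z ∈ C.wordX c₁ c₂) : y + z ∈ C.wordX c₁ c₂ := by
  have := wordSig_subset_wordK hC c₁ hy
  exact add_mem_wordX hC this (by rwa [PColor.inv_inv])

/-- The two arcs between the points have distances adding up to the total color sum, and translation
by total color sums preserves `wordX`. -/
theorem wordX_subset_swap (hC : C.IsCategory) (hz : z ∈ C.wordX c₁ c₂) :
    -z ∈ C.wordX c₂ c₁ := by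
  obtain ⟨α, a, b, u, v, h, hab, hX, rfl⟩ := hz
  have hS : -csum ((c₁, a) :: (u ++ (c₂, b) :: v)) ∈ C.wordSig :=
    neg_mem_wordSig hC ⟨_, _, h, rfl⟩
  have hr := Word.rotate (u := (c₁, a) :: u) (v := (c₂, b) :: v) hC (by simpa using h)
  have hX' := Crossing.rotate (l := labels ((c₁, a) :: u)) (l' := labels ((c₂, b) :: v))
    (by simpa using hX)
  have : csum v + offset c₂ c₁ ∈ C.wordX c₂ c₁ :=
    ⟨α, b, a, v, u, by simpa using hr, hab.symm, by simpa using hX'.symm, rfl⟩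
  have h' := add_wordSig_mem_wordX hC hS this
  convert h' using 1
  have := offset_comm_add c₁ c₂
  simp only [csum_cons, csum_append]
  linarith

theorem word_singletons (hC : C.IsCategory) (h : singletonsWB ∈ C 0 2) (c : PColor) :
    ∃ b b' : Fin 2, b ≠ b' ∧ C.Word [(c.inv, b), (c, b')] := by
  have h₁ : C.Word [(white, (0 : Fin 2)), (black, (1 : Fin 2))] := by
    refine ⟨0, 2, _, Sum.elim Fin.elim0 id, h, ?_, rfl, rfl⟩
    rintro (x | x) (y | y)
    · exact x.elim0
    · exact x.elim0
    · exact y.elim0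
    · exact ⟨fun h => Sum.inr.inj h, fun h => congrArg Sum.inr h⟩
  cases c with
  | white => exact ⟨1, 0, by decide, Word.rotate_one hC h₁⟩
  | black => exact ⟨0, 1, by decide, h₁⟩

theorem fourWBWB_mem_of_word {a : α} (h : C.Word [(white, a), (black, a), (white, a), (black, a)]) :
    fourWBWB ∈ C 0 4 := by
  obtain ⟨k, l, p, f, hp, hf, hk, hl⟩ := h
  obtain rfl : k = 0 := by simpa [upperWord] using congrArg List.length hk
  obtain rfl : l = 4 := by simpa [lowerWord] using congrArg List.length hl
  have hl' : (fun j => (p.lower j, f (Sum.inr j))) =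
      ![(white, a), (black, a), (white, a), (black, a)] := by
    apply List.ofFn_injective
    rw [← lowerWord, hl]
    rfl
  have hfa : ∀ x, f x = a := by
    rintro (x | x)
    · exact x.elim0
    · have := congrFun hl' x
      fin_cases x <;> exact congrArg Prod.snd this
  have hlow : p.lower = fourWBWB.lower := by
    funext x
    have := congrFun hl' x
    fin_cases x <;> exact congrArg Prod.fst this
  have hup : p.upper = fourWBWB.upper := funext fun x => x.elim0
  have hrel : p.rel = fourWBWB.rel := by
    refine Setoid.ext fun x y => ?_
    rw [hf, hfa, hfa]
    exact ⟨fun _ => trivial, fun _ => rfl⟩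
  have : p = fourWBWB := by
    cases p
    simp_all [fourWBWB]
  rwa [← this]

/-- Folding along the part containing a third leg keeps both copies of the block joined and puts
legs of colors `c₂`, `c₂.inv` next to each other. Folding again onto these two, with another leg in
the erased part, leaves four alternating legs of one block. -/
theorem fourWBWB_mem (hC : C.IsCategory) {a : α} {u v : LWord α}
    (h : C.Word ((c₁, a) :: (u ++ (c₂, a) :: v))) (ha : a ∈ labels v) : fourWBWB ∈ C 0 4 := by
  obtain ⟨g, hg, h₁⟩ := Word.fold (u := (c₁, a) :: (u ++ [(c₂, a)])) (v := v) hC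
    (by simpa using h)
  have h₂ := Word.rotate (u := lmap Sum.inl ((c₁, a) :: u)) hC
    (v := (c₂, Sum.inl a) :: (c₂.inv, Sum.inl a) :: (lmap g (bar u) ++ [(c₁.inv, Sum.inl a)]))
    (by simpa [hg a ha] using h₁)
  obtain ⟨g', hg', h₃⟩ := Word.fold (u := [(c₂, Sum.inl a), (c₂.inv, Sum.inl a)])
    (v := lmap g (bar u) ++ [(c₁.inv, Sum.inl a)] ++ lmap Sum.inl ((c₁, a) :: u)) hC
    (by simpa using h₂)
  have e := hg' (Sum.inl a) (by simp)
  have h₄ : C.Word [(c₂, (Sum.inl (Sum.inl a) : (α ⊕ α) ⊕ (α ⊕ α))), (c₂.inv, Sum.inl (Sum.inl a)),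
      (c₂, Sum.inl (Sum.inl a)), (c₂.inv, Sum.inl (Sum.inl a))] := by
    simpa [e] using h₃
  cases c₂ with
  | white => exact fourWBWB_mem_of_word h₄
  | black => exact fourWBWB_mem_of_word (Word.rotate_one hC h₄)

/-- In a non-hyperoctahedral category the distances between subsequent legs occur in two-legged
blocks. -/
theorem exists_two_legs (hC : C.IsNonHyperoctahedral) (hz : z ∈ C.wordK c₁ c₂) :
    ∃ (α : Type) (a : α) (u v : LWord α), C.Word ((c₁, a) :: (u ++ (c₂, a) :: v)) ∧
      a ∉ labels u ∧ a ∉ labels v ∧ z = csum u + offset c₁ c₂ := by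
  obtain ⟨hC, hs | hf⟩ := hC
  · have key : ∀ (n : ℕ) (α : Type) (a : α) (u v w : LWord α),
        C.Word ((c₁, a) :: (u ++ (c₂, a) :: (v ++ w))) → a ∉ labels u → a ∉ labels v →
        w.length ≤ n → ∃ (α : Type) (a : α) (u' v : LWord α),
          C.Word ((c₁, a) :: (u' ++ (c₂, a) :: v)) ∧ a ∉ labels u' ∧ a ∉ labels v ∧
            csum u + offset c₁ c₂ = csum u' + offset c₁ c₂ := by
      intro n
      induction n with
      | zero =>
        intro α a u v w h hu hv hw
        obtain rfl := List.eq_nil_of_length_eq_zero (Nat.le_zero.1 hw)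
        exact ⟨α, a, u, v, by simpa using h, hu, hv, rfl⟩
      | succ n ih =>
        intro α a u v w h hu hv hn
        by_cases haw : a ∈ labels w
        swap
        · exact ⟨α, a, u, v ++ w, h, hu, by simp [hv, haw], rfl⟩
        obtain ⟨c, s, t, rfl, hs'⟩ := exists_split_first haw
        -- Gluing two singletons to the leg of color `c` leaves a singleton of the same color in its
        -- place, which detaches the leg and changes no color sum.
        obtain ⟨b, b', hbb, hb⟩ := word_singletons hC hs c
        have h' : C.Word (t ++ ((c₁, a) :: (u ++ (c₂, a) :: (v ++ s ++ [(c, a)])))) :=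
          Word.rotate hC (by simpa using h)
        obtain ⟨g, hg, hgb, hg', hw⟩ := Word.join hC
          (u := t ++ (c₁, a) :: (u ++ (c₂, a) :: (v ++ s))) (c := c) (a := a)
          (by simpa using h') hb
        have hr := Word.rotate (u := lmap Sum.inl t) hC (by simpa using hw)
        have hne : Sum.inl a ≠ g b' := fun e => hbb (hg' _ _ e.symm).2.symm
        have := ih (α ⊕ Fin 2) (Sum.inl a) (lmap Sum.inl u)
          (lmap Sum.inl v ++ lmap Sum.inl s ++ [(c, g b')]) (lmap Sum.inl t) (by simpa using hr)
          (by simpa using hu) (by simp [hv, hs', hne])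
          (by
            simp only [List.length_append, List.length_cons] at hn
            rw [length_lmap]
            omega)
        simpa using this
    obtain ⟨α, a, u, v, h, hu, rfl⟩ := hz
    exact key v.length α a u [] v (by simpa using h) hu (by simp) le_rfl
  · obtain ⟨α, a, u, v, h, hu, rfl⟩ := hz
    exact ⟨α, a, u, v, h, hu, fun hv => hf (fourWBWB_mem hC h hv), rfl⟩

/-- For a two-legged block the complementary arc also joins subsequent legs. Its negative lies in
the set with inverted colors and differs from the original distance by the total color sum. -/
theorem wordK_subset_inv (hC : C.IsNonHyperoctahedral) :
    C.wordK c₁ c₂ ⊆ C.wordK c₁.inv c₂.inv := by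
  intro z hz
  obtain ⟨α, a, u, v, h, hu, hv, rfl⟩ := exists_two_legs hC hz
  have hS : csum ((c₁, a) :: (u ++ (c₂, a) :: v)) ∈ C.wordSig := ⟨_, _, h, rfl⟩
  have hr := Word.rotate (u := (c₁, a) :: u) (v := (c₂, a) :: v) hC.1 (by simpa using h)
  have : csum v + offset c₂ c₁ ∈ C.wordK c₂ c₁ := ⟨α, a, v, u, by simpa using hr, hv, rfl⟩
  have h' := add_wordSig_mem_wordK hC.1 hS (neg_mem_wordK hC.1 this)
  convert h' using 1
  have := offset_comm_add c₁ c₂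
  simp only [csum_cons, csum_append]
  linarith

/-- A crossing block has another leg. Splitting the path at that leg gives a `K`-distance plus an
`X`-distance, and inverting both colors of the `K`-part flips only the starting color of the sum. -/
theorem wordX_subset_inv_left (hC : C.IsNonHyperoctahedral) :
    C.wordX c₁ c₂ ⊆ C.wordX c₁.inv c₂ := by
  classical
  rintro _ ⟨α, a, b, u, v, h, hab, hX, rfl⟩
  have hmem : a ∈ labels u ∨ a ∈ labels v := by
    have h2 : 2 ≤ (labels ((c₁, a) :: (u ++ (c₂, b) :: v))).count a := by
      rcases hX with hX | hX <;> refine le_trans ?_ (hX.count_le a) <;>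
        simp [hab.symm]
    by_contra! hn
    simp [hab.symm, List.count_eq_zero.2 hn.1, List.count_eq_zero.2 hn.2] at h2
  have step : ∀ {c : PColor} {y z : ℤ}, y ∈ C.wordK c₁ c → z ∈ C.wordX c c₂ →
      y + z ∈ C.wordX c₁.inv c₂ := by
    intro c y z hy hz
    have hy' := wordK_subset_inv hC hy
    exact add_mem_wordX hC.1 hy' (by rwa [PColor.inv_inv])
  rcases hmem with hu | hv
  · obtain ⟨c, u₁, u₂, rfl, hu₁⟩ := exists_split_first hu
    have hr := Word.rotate (u := (c₁, a) :: u₁) (v := (c, a) :: (u₂ ++ (c₂, b) :: v)) hC.1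
      (by simpa using h)
    have hX' := Crossing.rotate (l := labels ((c₁, a) :: u₁))
      (l' := labels ((c, a) :: (u₂ ++ (c₂, b) :: v))) (by simpa using hX)
    have hk : csum u₁ + offset c₁ c ∈ C.wordK c₁ c :=
      ⟨α, a, u₁, u₂ ++ (c₂, b) :: v, by simpa using h, hu₁, rfl⟩
    have hx : csum u₂ + offset c c₂ ∈ C.wordX c c₂ :=
      ⟨α, a, b, u₂, v ++ (c₁, a) :: u₁, by simpa using hr, hab, by simpa using hX', rfl⟩
    convert step hk hx using 1
    have := offset_add c₁ c c₂
    simp only [csum_cons, csum_append]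
    linarith
  -- The other leg now precedes the starting point cyclically, so the `K`-distance is traversed
  -- backwards and the `X`-path passes over the starting point.
  · obtain ⟨c, v₁, v₂, rfl, hv₂⟩ := exists_split_last hv
    have hr := Word.rotate (u := (c₁, a) :: (u ++ (c₂, b) :: v₁)) (v := (c, a) :: v₂) hC.1
      (by simpa using h)
    have hX' := Crossing.rotate (l := labels ((c₁, a) :: (u ++ (c₂, b) :: v₁)))
      (l' := labels ((c, a) :: v₂)) (by simpa using hX)
    have hk : csum v₂ + offset c c₁ ∈ C.wordK c c₁ :=
      ⟨α, a, v₂, u ++ (c₂, b) :: v₁, by simpa using hr, hv₂, rfl⟩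
    have hx : csum (v₂ ++ (c₁, a) :: u) + offset c c₂ ∈ C.wordX c c₂ :=
      ⟨α, a, b, v₂ ++ (c₁, a) :: u, v₁, by simpa using hr, hab, by simpa using hX', rfl⟩
    have hk' := wordK_subset_inv hC (neg_mem_wordK hC.1 hk)
    rw [PColor.inv_inv, PColor.inv_inv] at hk'
    convert step hk' hx using 1
    have := offset_add c c₁ c₂
    simp only [csum_cons, csum_append]
    linarith

end TCPartitionSet

/-! ### Translation between points of partitions and letters of words -/

namespace LWord

theorem sublist_four_iff {α : Type} {a b c d : α} {l : List α} :
    List.Sublist [a, b, c, d] l ↔ ∃ i j m n : ℕ, i < j ∧ j < m ∧ m < n ∧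
      l[i]? = some a ∧ l[j]? = some b ∧ l[m]? = some c ∧ l[n]? = some d := by
  rw [List.sublist_iff_exists_fin_orderEmbedding_get_eq]
  constructor
  · rintro ⟨f, hf⟩
    have h : ∀ i : Fin 4, l[(f i : ℕ)]? = some ([a, b, c, d].get i) := fun i => by
      rw [hf i]
      exact List.getElem?_eq_getElem _
    refine ⟨f (0 : Fin 4), f (1 : Fin 4), f (2 : Fin 4), f (3 : Fin 4), ?_, ?_, ?_,
      h 0, h 1, h 2, h 3⟩
    · exact f.strictMono (show (0 : Fin 4) < 1 by decide)
    · exact f.strictMono (show (1 : Fin 4) < 2 by decide)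
    · exact f.strictMono (show (2 : Fin 4) < 3 by decide)
  · rintro ⟨i, j, m, n, hij, hjm, hmn, hi, hj, hm, hn⟩
    obtain ⟨hi', hi⟩ := List.getElem?_eq_some_iff.1 hi
    obtain ⟨hj', hj⟩ := List.getElem?_eq_some_iff.1 hj
    obtain ⟨hm', hm⟩ := List.getElem?_eq_some_iff.1 hm
    obtain ⟨hn', hn⟩ := List.getElem?_eq_some_iff.1 hn
    let g : Fin 4 → Fin l.length := ![⟨i, hi'⟩, ⟨j, hj'⟩, ⟨m, hm'⟩, ⟨n, hn'⟩]
    have hg : StrictMono g := by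
      rw [Fin.strictMono_iff_lt_succ]
      intro x
      fin_cases x
      · exact hij
      · exact hjm
      · exact hmn
    refine ⟨OrderEmbedding.ofStrictMono g hg, fun x => ?_⟩
    change Fin 4 at x
    fin_cases x
    · exact hi.symm
    · exact hj.symm
    · exact hm.symm
    · exact hn.symm

theorem eq_append_cons_of_getElem? {α : Type} {l : List α} {i : ℕ} {x : α} (h : l[i]? = some x) :
    ∃ u v, l = u ++ x :: v ∧ u.length = i := by
  obtain ⟨hi, rfl⟩ := List.getElem?_eq_some_iff.1 h
  refine ⟨l.take i, l.drop (i + 1), ?_, by simp; omega⟩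
  rw [List.getElem_cons_drop, List.take_append_drop]

end LWord

namespace TCPartition

variable {k l : ℕ} {ι : Type}

theorem pos_injective : Function.Injective (pos : PPoint k l → ℕ) := by
  rintro (x | x) (y | y) h
  · simp only [pos, Nat.add_left_cancel_iff] at h
    exact congrArg Sum.inl (Fin.rev_injective (Fin.ext h))
  · simp only [pos] at h; omega
  · simp only [pos] at h; omega
  · exact congrArg Sum.inr (Fin.ext h)

theorem exists_pos_eq {i : ℕ} (h : i < k + l) : ∃ x : PPoint k l, pos x = i := by
  by_cases hi : i < l
  · exact ⟨Sum.inr ⟨i, hi⟩, rfl⟩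
  · refine ⟨Sum.inl (Fin.rev ⟨i - l, by omega⟩), ?_⟩
    simp only [pos, Fin.rev_rev]
    omega

theorem pos_lt (x : PPoint k l) : pos x < k + l := by
  rcases x with x | x <;> simp only [pos] <;> omega

/-- The word of all points of a partition in the cyclic order. -/
def word (p : TCPartition k l) (f : PPoint k l → ι) : LWord ι :=
  p.lowerWord f ++ bar (p.upperWord f)

theorem length_word (p : TCPartition k l) (f : PPoint k l → ι) : (p.word f).length = k + l := by
  simp [word, lowerWord, upperWord, add_comm]

/-- Reversing and inverting the upper row is precisely what `pos` and `normColor` prescribe there.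
-/
theorem word_getElem? (p : TCPartition k l) (f : PPoint k l → ι) (x : PPoint k l) :
    (p.word f)[pos x]? = some (p.normColor x, f x) := by
  rcases x with x | x
  · have h : pos (Sum.inl x : PPoint k l) = (p.lowerWord f).length + x.rev := by
      simp [pos, lowerWord]
    rw [h, word, List.getElem?_append_right (by omega), Nat.add_sub_cancel_left, bar,
      List.getElem?_reverse (by simpa [upperWord] using x.pos)]
    have h' : (List.map (Prod.map inv id) (p.upperWord f)).length - 1 - (x.rev : ℕ) = x := by
      have := x.2
      simp [upperWord, Fin.val_rev]
      omega
    rw [h']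
    simp [upperWord, normColor]
  · rw [word, List.getElem?_append_left (by simp [pos, lowerWord])]
    simp [pos, lowerWord, normColor]

theorem colorSum_eq_csum (p : TCPartition k l) (f : PPoint k l → ι) {u v w : LWord ι}
    (h : p.word f = u ++ (v ++ w)) (S : Finset (PPoint k l))
    (hS : ∀ x, x ∈ S ↔ u.length ≤ pos x ∧ pos x < u.length + v.length) :
    p.colorSum S = csum v := by
  have e : csum v = ∑ i : Fin v.length, (v.get i).1.sign := by
    rw [csum, ← List.sum_ofFn]
    congr 1
    conv_lhs => rw [← List.ofFn_get v]
    rw [List.map_ofFn]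
    rfl
  have hl : u.length + v.length ≤ k + l := by
    rw [← p.length_word f, h]
    simp
  rw [e, colorSum]
  refine Finset.sum_bij (fun x hx => ⟨pos x - u.length, by have := (hS x).1 hx; omega⟩)
    (fun _ _ => Finset.mem_univ _) ?_ ?_ ?_
  · intro x hx y hy hxy
    have := (hS x).1 hx
    have := (hS y).1 hy
    simp only [Fin.mk.injEq] at hxy
    exact pos_injective (by omega)
  · intro i _
    obtain ⟨x, hx⟩ := exists_pos_eq (k := k) (l := l) (i := u.length + i) (by omega)
    exact ⟨x, (hS x).2 (by omega), by simp [hx]⟩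
  · intro x hx
    have hx' := (hS x).1 hx
    have := p.word_getElem? f x
    rw [h, List.getElem?_append_right hx'.1, List.getElem?_append_left (by omega)] at this
    obtain ⟨_, e⟩ := List.getElem?_eq_some_iff.1 this
    simp [e]

theorem exists_point_of_mem (p : TCPartition k l) (f : PPoint k l → ι) {u v w : LWord ι}
    (h : p.word f = u ++ (v ++ w)) {a : ι} (ha : a ∈ labels v) :
    ∃ x, u.length ≤ pos x ∧ pos x < u.length + v.length ∧ f x = a := by
  obtain ⟨y, hy, rfl⟩ := List.mem_map.1 ha
  obtain ⟨i, hi, rfl⟩ := List.mem_iff_getElem.1 hy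
  have hl : u.length + v.length ≤ k + l := by
    rw [← p.length_word f, h]
    simp
  obtain ⟨x, hx⟩ := exists_pos_eq (k := k) (l := l) (i := u.length + i) (by omega)
  refine ⟨x, by omega, by omega, ?_⟩
  have := p.word_getElem? f x
  rw [hx, h, List.getElem?_append_right (by omega), List.getElem?_append_left (by omega),
    Nat.add_sub_cancel_left, List.getElem?_eq_getElem hi] at this
  rw [Option.some.inj this]

theorem label_mem (p : TCPartition k l) (f : PPoint k l → ι) {u v w : LWord ι}
    (h : p.word f = u ++ (v ++ w)) (x : PPoint k l) (hx : u.length ≤ pos x)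
    (hx' : pos x < u.length + v.length) : f x ∈ labels v := by
  have := p.word_getElem? f x
  rw [h, List.getElem?_append_right hx, List.getElem?_append_left (by omega)] at this
  exact mem_labels_of_mem (List.mem_of_getElem? this)

theorem mem_Ioo {α β γ : PPoint k l} : γ ∈ Ioo α β ↔ Ordered₃ α γ β := by
  simp [Ioo]

theorem colorDist_eq (p : TCPartition k l) {α β : PPoint k l} (h : α ≠ β) :
    p.colorDist α β = p.colorSum (Ioo α β) + offset (p.normColor α) (p.normColor β) := by
  classical
  have hI : Ioc α β = insert β (Ioo α β) := by
    ext γ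
    simp only [Ioc, Finset.mem_filter, Finset.mem_univ, true_and, Finset.mem_insert, mem_Ioo]
    constructor
    · exact fun h => h.2
    · rintro (rfl | h')
      · exact ⟨h.symm, Or.inl rfl⟩
      · refine ⟨?_, Or.inr h'⟩
        rintro rfl
        unfold Ordered₃ at h'
        omega
  have hn : β ∉ Ioo α β := by
    rw [mem_Ioo]
    unfold Ordered₃
    omega
  unfold colorDist
  rw [hI, colorSum, Finset.sum_insert hn, ← colorSum]
  cases hα : p.normColor α <;> cases hβ : p.normColor β <;> simp [sign, offset, add_comm]

theorem colorSum_Ioo (p : TCPartition k l) (f : PPoint k l → ι) {u v w : LWord ι}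
    {x y : PColor × ι} (h : p.word f = u ++ x :: (v ++ y :: w)) {α β : PPoint k l}
    (hα : pos α = u.length) (hβ : pos β = u.length + 1 + v.length) :
    p.colorSum (Ioo α β) = csum v := by
  refine p.colorSum_eq_csum f (u := u ++ [x]) (w := y :: w) (by simpa using h) _ fun z => ?_
  rw [mem_Ioo, Ordered₃, List.length_append, List.length_singleton]
  omega

theorem colorSum_Ioo' (p : TCPartition k l) (f : PPoint k l → ι) {u v w : LWord ι}
    {x y : PColor × ι} (h : p.word f = u ++ x :: (v ++ y :: w)) {α β : PPoint k l}
    (hα : pos α = u.length) (hβ : pos β = u.length + 1 + v.length) :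
    p.colorSum (Ioo β α) = csum (w ++ u) := by
  classical
  have hlen := p.length_word f
  rw [h] at hlen
  simp only [List.length_append, List.length_cons] at hlen
  have h₁ := p.colorSum_eq_csum f (u := []) (v := u) (w := x :: (v ++ y :: w)) h
    {z | pos z < pos α} (by simp [hα])
  have h₂ := p.colorSum_eq_csum f (u := u ++ x :: (v ++ [y])) (v := w) (w := [])
    (by simpa using h) {z | pos β < pos z} fun z => by
      have := pos_lt z
      simp only [Finset.mem_filter, Finset.mem_univ, true_and, List.length_append,
        List.length_cons, List.length_nil]
      omega
  rw [csum_append, ← h₁, ← h₂, colorSum, colorSum, colorSum, ← Finset.sum_union]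
  · congr 1
    ext z
    simp only [mem_Ioo, Ordered₃, Finset.mem_union, Finset.mem_filter, Finset.mem_univ, true_and]
    omega
  · rw [Finset.disjoint_left]
    intro z hz hz'
    simp only [Finset.mem_filter, Finset.mem_univ, true_and] at hz hz'
    omega

theorem exists_word_split (p : TCPartition k l) (f : PPoint k l → ι) {α β : PPoint k l}
    (h : pos α < pos β) : ∃ u v w,
      p.word f = u ++ (p.normColor α, f α) :: (v ++ (p.normColor β, f β) :: w) ∧
        pos α = u.length ∧ pos β = u.length + 1 + v.length := by
  obtain ⟨u, v', h₁, hu⟩ := eq_append_cons_of_getElem? (p.word_getElem? f α)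
  have hβ := p.word_getElem? f β
  rw [h₁, List.getElem?_append_right (by omega)] at hβ
  obtain ⟨n, hn⟩ : ∃ n, pos β - u.length = n + 1 := ⟨pos β - u.length - 1, by omega⟩
  rw [hn, List.getElem?_cons_succ] at hβ
  obtain ⟨v, w, rfl, hv⟩ := eq_append_cons_of_getElem? hβ
  exact ⟨u, v, w, h₁, hu.symm, by omega⟩

/-- Rotation brings `α` to the front, so that a cyclic interval wrapping past the last position also
becomes a segment of a word. -/
theorem exists_rotated_word (p : TCPartition k l) (f : PPoint k l → ι) {α β : PPoint k l}
    (h : α ≠ β) : ∃ v w u₁ u₂, p.word f = u₁ ++ u₂ ∧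
      u₂ ++ u₁ = (p.normColor α, f α) :: (v ++ (p.normColor β, f β) :: w) ∧
      p.colorDist α β = csum v + offset (p.normColor α) (p.normColor β) ∧
      ∀ a ∈ labels v, ∃ γ ∈ Ioo α β, f γ = a := by
  rw [p.colorDist_eq h]
  rcases lt_or_gt_of_ne fun e => h (pos_injective e) with hlt | hlt
  · obtain ⟨u, v, w, hw, hα, hβ⟩ := p.exists_word_split f hlt
    refine ⟨v, w ++ u, u, _, hw, by simp, by rw [p.colorSum_Ioo f hw hα hβ], fun a ha => ?_⟩
    obtain ⟨γ, h₁, h₂, rfl⟩ := p.exists_point_of_mem f (u := u ++ [(p.normColor α, f α)])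
      (w := (p.normColor β, f β) :: w) (by simpa using hw) ha
    rw [List.length_append, List.length_singleton] at h₁ h₂
    exact ⟨γ, mem_Ioo.2 (by unfold Ordered₃; omega), rfl⟩
  · obtain ⟨u, v, w, hw, hβ, hα⟩ := p.exists_word_split f hlt
    refine ⟨w ++ u, v, u ++ (p.normColor β, f β) :: v, (p.normColor α, f α) :: w, by simpa using hw,
      by simp, by rw [p.colorSum_Ioo' f hw hβ hα], fun a ha => ?_⟩
    rw [labels_append, List.mem_append] at ha
    rcases ha with ha | ha
    · obtain ⟨γ, h₁, h₂, rfl⟩ := p.exists_point_of_mem f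
        (u := u ++ (p.normColor β, f β) :: (v ++ [(p.normColor α, f α)])) (w := [])
        (by simpa using hw) ha
      simp only [List.length_append, List.length_cons, List.length_nil] at h₁ h₂
      exact ⟨γ, mem_Ioo.2 (by unfold Ordered₃; omega), rfl⟩
    · obtain ⟨γ, h₁, h₂, rfl⟩ := p.exists_point_of_mem f (u := []) hw ha
      simp only [List.length_nil] at h₁ h₂
      exact ⟨γ, mem_Ioo.2 (by unfold Ordered₃; omega), rfl⟩

theorem totalColorSum_eq (p : TCPartition k l) (f : PPoint k l → ι) :
    p.totalColorSum = csum (p.word f) :=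
  p.colorSum_eq_csum f (u := []) (w := []) (by simp) _ fun x => by
    simp [length_word, pos_lt]

theorem mem_blocks_iff (p : TCPartition k l) (f : PPoint k l → ι)
    (hf : ∀ x y, p.rel x y ↔ f x = f y) {B : Set (PPoint k l)} :
    B ∈ p.blocks ↔ ∃ y, B = {x | f x = f y} := by
  simp [blocks, Setoid.classes, hf]

theorem eq_of_mem_blocks (p : TCPartition k l) (f : PPoint k l → ι)
    (hf : ∀ x y, p.rel x y ↔ f x = f y) {B : Set (PPoint k l)} (hB : B ∈ p.blocks)
    {α : PPoint k l} (hα : α ∈ B) : B = {x | f x = f α} := by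
  obtain ⟨y, rfl⟩ := (p.mem_blocks_iff f hf).1 hB
  have : f α = f y := hα
  rw [this]

theorem labels_word_getElem? (p : TCPartition k l) (f : PPoint k l → ι) (x : PPoint k l) :
    (labels (p.word f))[pos x]? = some (f x) := by
  rw [labels, List.getElem?_map, word_getElem?]
  rfl

theorem crossing_of_cross (p : TCPartition k l) (f : PPoint k l → ι) {a b : ι}
    (h : Cross {x | f x = a} {x | f x = b}) : Crossing a b (labels (p.word f)) := by
  obtain ⟨-, α₁, h₁, β₁, h₁', α₂, h₂, β₂, h₂', h, h'⟩ := h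
  have e₁ := p.labels_word_getElem? f α₁
  have e₁' := p.labels_word_getElem? f β₁
  have e₂ := p.labels_word_getElem? f α₂
  have e₂' := p.labels_word_getElem? f β₂
  simp only [Set.mem_ofPred_eq] at h₁ h₁' h₂ h₂'
  rw [h₁] at e₁
  rw [h₁'] at e₁'
  rw [h₂] at e₂
  rw [h₂'] at e₂'
  unfold Ordered₃ at h h'
  unfold Crossing
  rw [sublist_four_iff, sublist_four_iff]
  -- A cyclic order of four points has four linear forms, depending on where the circle is cut.
  have : (pos α₁ < pos α₂ ∧ pos α₂ < pos β₁ ∧ pos β₁ < pos β₂) ∨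
      (pos α₂ < pos β₁ ∧ pos β₁ < pos β₂ ∧ pos β₂ < pos α₁) ∨
      (pos β₁ < pos β₂ ∧ pos β₂ < pos α₁ ∧ pos α₁ < pos α₂) ∨
      (pos β₂ < pos α₁ ∧ pos α₁ < pos α₂ ∧ pos α₂ < pos β₁) := by omega
  rcases this with ⟨i, j, m⟩ | ⟨i, j, m⟩ | ⟨i, j, m⟩ | ⟨i, j, m⟩
  · exact Or.inl ⟨_, _, _, _, i, j, m, e₁, e₂, e₁', e₂'⟩
  · exact Or.inr ⟨_, _, _, _, i, j, m, e₂, e₁', e₂', e₁⟩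
  · exact Or.inl ⟨_, _, _, _, i, j, m, e₁', e₂', e₁, e₂⟩
  · exact Or.inr ⟨_, _, _, _, i, j, m, e₂', e₁, e₂, e₁'⟩

theorem cross_of_crossing (p : TCPartition k l) (f : PPoint k l → ι) {a b : ι} (hab : a ≠ b)
    (h : Crossing a b (labels (p.word f))) : Cross {x | f x = a} {x | f x = b} := by
  have pt : ∀ {i : ℕ} {c : ι}, (labels (p.word f))[i]? = some c → ∃ x, pos x = i ∧ f x = c := by
    intro i c h
    obtain ⟨hi, -⟩ := List.getElem?_eq_some_iff.1 h
    rw [labels, List.length_map, length_word] at hi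
    obtain ⟨x, rfl⟩ := exists_pos_eq hi
    exact ⟨x, rfl, Option.some.inj ((p.labels_word_getElem? f x).symm.trans h)⟩
  rw [Crossing, sublist_four_iff, sublist_four_iff] at h
  rcases h with ⟨_, _, _, _, i, j, m, e₁, e₂, e₃, e₄⟩ | ⟨_, _, _, _, i, j, m, e₁, e₂, e₃, e₄⟩ <;>
    obtain ⟨x₁, rfl, h₁⟩ := pt e₁ <;> obtain ⟨x₂, rfl, h₂⟩ := pt e₂ <;>
    obtain ⟨x₃, rfl, h₃⟩ := pt e₃ <;> obtain ⟨x₄, rfl, h₄⟩ := pt e₄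
  · exact ⟨fun e => hab (h₁.symm.trans (e.le h₁)), x₁, h₁, x₃, h₃, x₂, h₂, x₄, h₄,
      Or.inl ⟨i, j⟩, Or.inl ⟨by omega, m⟩⟩
  · exact ⟨fun e => hab ((e.ge h₁).symm.trans h₁), x₂, h₂, x₄, h₄, x₃, h₃, x₁, h₁,
      Or.inl ⟨j, m⟩, Or.inr (Or.inr ⟨i, by omega⟩)⟩

end TCPartition

namespace TCPartitionSet

open TCPartition

variable {C : TCPartitionSet} {c₁ c₂ : PColor}

theorem word_mem (hC : C.IsCategory) {k l : ℕ} {p : TCPartition k l} (hp : p ∈ C k l) {ι : Type}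
    {f : PPoint k l → ι} (hf : ∀ x y, p.rel x y ↔ f x = f y) : C.Word (p.word f) :=
  Rep.word hC ⟨k, l, p, f, hp, hf, rfl, rfl⟩

theorem Word.exists_partition {ι : Type} {w : LWord ι} (h : C.Word w) :
    ∃ (k l : ℕ) (p : TCPartition k l) (f : PPoint k l → ι), p ∈ C k l ∧
      (∀ x y, p.rel x y ↔ f x = f y) ∧ p.word f = w := by
  obtain ⟨k, l, p, f, hp, hf, hk, rfl⟩ := h
  exact ⟨k, l, p, f, hp, hf, by simp [TCPartition.word, hk]⟩

theorem exists_labelling {k l : ℕ} (p : TCPartition k l) :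
    ∃ (ι : Type) (f : PPoint k l → ι), ∀ x y, p.rel x y ↔ f x = f y :=
  ⟨Quotient p.rel, Quotient.mk _, fun _ _ => Quotient.eq.symm⟩

theorem sig_eq (hC : C.IsCategory) : C.Sig = C.wordSig := by
  ext z
  constructor
  · rintro ⟨k, l, p, hp, rfl⟩
    obtain ⟨ι, f, hf⟩ := exists_labelling p
    exact ⟨ι, _, word_mem hC hp hf, p.totalColorSum_eq f⟩
  · rintro ⟨ι, w, hw, rfl⟩
    obtain ⟨k, l, p, f, hp, -, rfl⟩ := hw.exists_partition
    exact ⟨k, l, p, hp, (p.totalColorSum_eq f).symm⟩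

/-- The points belonging to two given positions of a word. -/
theorem Word.exists_points {ι : Type} {a b : ι} {u v : LWord ι}
    (h : C.Word ((c₁, a) :: (u ++ (c₂, b) :: v))) :
    ∃ (k l : ℕ) (p : TCPartition k l) (f : PPoint k l → ι) (α β : PPoint k l), p ∈ C k l ∧
      (∀ x y, p.rel x y ↔ f x = f y) ∧ p.word f = (c₁, a) :: (u ++ (c₂, b) :: v) ∧ α ≠ β ∧
      p.normColor α = c₁ ∧ f α = a ∧ p.normColor β = c₂ ∧ f β = b ∧
      (∀ γ ∈ Ioo α β, f γ ∈ labels u) ∧ p.colorDist α β = csum u + offset c₁ c₂ := by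
  obtain ⟨k, l, p, f, hp, hf, hw⟩ := h.exists_partition
  have hl := p.length_word f
  rw [hw] at hl
  simp only [List.length_append, List.length_cons] at hl
  obtain ⟨α, hα⟩ := exists_pos_eq (k := k) (l := l) (i := 0) (by omega)
  obtain ⟨β, hβ⟩ := exists_pos_eq (k := k) (l := l) (i := 1 + u.length) (by omega)
  have hne : α ≠ β := by
    rintro rfl
    omega
  have eα := p.word_getElem? f α
  have eβ := p.word_getElem? f β
  rw [hw, hα] at eα
  rw [hw, hβ, add_comm, List.getElem?_cons_succ, List.getElem?_append_right le_rfl,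
    Nat.sub_self] at eβ
  obtain ⟨hcα, hfα⟩ := Prod.mk.inj (Option.some.inj eα)
  obtain ⟨hcβ, hfβ⟩ := Prod.mk.inj (Option.some.inj eβ)
  refine ⟨k, l, p, f, α, β, hp, hf, hw, hne, hcα.symm, hfα.symm, hcβ.symm, hfβ.symm,
    fun γ hγ => ?_, ?_⟩
  · rw [mem_Ioo] at hγ
    unfold Ordered₃ at hγ
    exact p.label_mem f (u := [(c₁, a)]) (w := (c₂, b) :: v) hw γ
      (by rw [List.length_singleton]; omega) (by rw [List.length_singleton]; omega)
  · rw [p.colorDist_eq hne, p.colorSum_Ioo f (u := []) hw hα (by rw [hβ]; simp), ← hcα, ← hcβ]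

theorem kcol_eq (hC : C.IsCategory) (c₁ c₂ : PColor) : Kcol c₁ c₂ C = C.wordK c₁ c₂ := by
  ext z
  constructor
  · rintro ⟨k, l, p, B, α, β, hp, ⟨hB, hα, hβ, hne, hI⟩, rfl, rfl, rfl⟩
    obtain ⟨ι, f, hf⟩ := exists_labelling p
    have hB' := p.eq_of_mem_blocks f hf hB hα
    have hfβ : f β = f α := by
      rw [hB'] at hβ
      exact hβ
    obtain ⟨v, w, u₁, u₂, h, h', hd, hv⟩ := p.exists_rotated_word f hne
    have hw := word_mem hC hp hf
    rw [h] at hw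
    have hw' := Word.rotate hC hw
    rw [h', hfβ] at hw'
    refine ⟨ι, f α, v, w, hw', fun hmem => ?_, hd⟩
    obtain ⟨γ, hγ, e⟩ := hv _ hmem
    have : γ ∈ (Ioo α β : Set (PPoint k l)) ∩ B := ⟨hγ, by rw [hB']; exact e⟩
    rw [hI] at this
    exact this
  · rintro ⟨ι, a, u, v, h, hu, rfl⟩
    obtain ⟨k, l, p, f, α, β, hp, hf, hw, hne, hcα, hfα, hcβ, hfβ, hI, hd⟩ := h.exists_points
    refine ⟨k, l, p, {x | f x = f α}, α, β, hp, ⟨(p.mem_blocks_iff f hf).2 ⟨α, rfl⟩, rfl,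
      hfβ.trans hfα.symm, hne, ?_⟩, hcα, hcβ, hd.symm⟩
    rw [Set.eq_empty_iff_forall_notMem]
    rintro γ ⟨hγ, hγ'⟩
    apply hu
    have := hI γ hγ
    rwa [show f γ = a from Eq.trans hγ' hfα] at this

theorem xcol_eq (hC : C.IsCategory) (c₁ c₂ : PColor) : Xcol c₁ c₂ C = C.wordX c₁ c₂ := by
  ext z
  constructor
  · rintro ⟨k, l, p, B₁, B₂, α, β, hp, hB₁, hB₂, hX, hα, hβ, rfl, rfl, rfl⟩
    obtain ⟨ι, f, hf⟩ := exists_labelling p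
    obtain rfl := p.eq_of_mem_blocks f hf hB₁ hα
    obtain rfl := p.eq_of_mem_blocks f hf hB₂ hβ
    have hab : f α ≠ f β := fun e => hX.1 (by rw [e])
    have hne : α ≠ β := fun e => hab (by rw [e])
    obtain ⟨v, w, u₁, u₂, h, h', hd, -⟩ := p.exists_rotated_word f hne
    have hw := word_mem hC hp hf
    have hX' := p.crossing_of_cross f hX
    rw [h] at hw hX'
    have hw' := Word.rotate hC hw
    rw [labels_append] at hX'
    have hX'' := hX'.rotate
    rw [← labels_append, h'] at hX''
    rw [h'] at hw'
    exact ⟨ι, f α, f β, v, w, hw', hab, hX'', hd⟩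
  · rintro ⟨ι, a, b, u, v, h, hab, hX, rfl⟩
    obtain ⟨k, l, p, f, α, β, hp, hf, hw, hne, hcα, hfα, hcβ, hfβ, -, hd⟩ := h.exists_points
    rw [← hw] at hX
    refine ⟨k, l, p, _, _, α, β, hp, ?_, ?_, p.cross_of_crossing f hab hX, hfα, hfβ, hcα, hcβ,
      hd.symm⟩
    · exact (p.mem_blocks_iff f hf).2 ⟨α, by rw [hfα]⟩
    · exact (p.mem_blocks_iff f hf).2 ⟨β, by rw [hfβ]⟩

/-! ### Decomposition by colors and independence of colors -/

theorem _root_.TCPartition.colorSum_pair {k l : ℕ} (p : TCPartition k l) {α β : PPoint k l}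
    (h : α ≠ β) : p.colorSum {α, β} = (p.normColor α).sign + (p.normColor β).sign := by
  rw [colorSum, Finset.sum_pair h]

theorem L_eq : C.L = Kcol white white C ∪ Kcol black black C := by
  ext z
  constructor
  · rintro ⟨k, l, p, B, α, β, hp, hS, hc, rfl⟩
    rw [p.colorSum_pair hS.2.2.2.1] at hc
    rcases hα : p.normColor α <;> rcases hβ : p.normColor β
    · exact Or.inl ⟨k, l, p, B, α, β, hp, hS, hα, hβ, rfl⟩
    · simp [hα, hβ, sign] at hc
    · simp [hα, hβ, sign] at hc
    · exact Or.inr ⟨k, l, p, B, α, β, hp, hS, hα, hβ, rfl⟩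
  · rintro (⟨k, l, p, B, α, β, hp, hS, hα, hβ, rfl⟩ | ⟨k, l, p, B, α, β, hp, hS, hα, hβ, rfl⟩) <;>
      exact ⟨k, l, p, B, α, β, hp, hS,
        by rw [p.colorSum_pair hS.2.2.2.1, hα, hβ]; decide, rfl⟩

theorem K_eq : C.K = Kcol white black C ∪ Kcol black white C := by
  ext z
  constructor
  · rintro ⟨k, l, p, B, α, β, hp, hS, hc, rfl⟩
    rw [p.colorSum_pair hS.2.2.2.1] at hc
    rcases hα : p.normColor α <;> rcases hβ : p.normColor β
    · simp [hα, hβ, sign] at hc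
    · exact Or.inl ⟨k, l, p, B, α, β, hp, hS, hα, hβ, rfl⟩
    · exact Or.inr ⟨k, l, p, B, α, β, hp, hS, hα, hβ, rfl⟩
    · simp [hα, hβ, sign] at hc
  · rintro (⟨k, l, p, B, α, β, hp, hS, hα, hβ, rfl⟩ | ⟨k, l, p, B, α, β, hp, hS, hα, hβ, rfl⟩) <;>
      exact ⟨k, l, p, B, α, β, hp, hS,
        by rw [p.colorSum_pair hS.2.2.2.1, hα, hβ]; decide, rfl⟩

theorem X_eq : C.X = Xcol white white C ∪ Xcol black black C ∪
    (Xcol white black C ∪ Xcol black white C) := by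
  ext z
  constructor
  · rintro ⟨k, l, p, B₁, B₂, α, β, hp, hB₁, hB₂, hX, hα, hβ, rfl⟩
    rcases hcα : p.normColor α <;> rcases hcβ : p.normColor β
    · exact Or.inl (Or.inl ⟨k, l, p, B₁, B₂, α, β, hp, hB₁, hB₂, hX, hα, hβ, hcα, hcβ, rfl⟩)
    · exact Or.inr (Or.inl ⟨k, l, p, B₁, B₂, α, β, hp, hB₁, hB₂, hX, hα, hβ, hcα, hcβ, rfl⟩)
    · exact Or.inr (Or.inr ⟨k, l, p, B₁, B₂, α, β, hp, hB₁, hB₂, hX, hα, hβ, hcα, hcβ, rfl⟩)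
    · exact Or.inl (Or.inr ⟨k, l, p, B₁, B₂, α, β, hp, hB₁, hB₂, hX, hα, hβ, hcα, hcβ, rfl⟩)
  · rintro ((⟨k, l, p, B₁, B₂, α, β, hp, hB₁, hB₂, hX, hα, hβ, -, -, rfl⟩ |
      ⟨k, l, p, B₁, B₂, α, β, hp, hB₁, hB₂, hX, hα, hβ, -, -, rfl⟩) |
      (⟨k, l, p, B₁, B₂, α, β, hp, hB₁, hB₂, hX, hα, hβ, -, -, rfl⟩ |
      ⟨k, l, p, B₁, B₂, α, β, hp, hB₁, hB₂, hX, hα, hβ, -, -, rfl⟩)) <;>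
      exact ⟨k, l, p, B₁, B₂, α, β, hp, hB₁, hB₂, hX, hα, hβ, rfl⟩

theorem wordK_inv (hC : C.IsNonHyperoctahedral) (c₁ c₂ : PColor) :
    C.wordK c₁.inv c₂.inv = C.wordK c₁ c₂ := by
  refine Set.Subset.antisymm (fun z hz => ?_) (wordK_subset_inv hC)
  simpa using wordK_subset_inv hC hz

theorem wordX_inv_left (hC : C.IsNonHyperoctahedral) (c₁ c₂ : PColor) :
    C.wordX c₁.inv c₂ = C.wordX c₁ c₂ := by
  refine Set.Subset.antisymm (fun z hz => ?_) (wordX_subset_inv_left hC)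
  simpa using wordX_subset_inv_left hC hz

/-- Swapping the points and then reflecting inverts both colors and restores the value; the left
inversion is then undone. -/
theorem wordX_inv_right (hC : C.IsNonHyperoctahedral) (c₁ c₂ : PColor) :
    C.wordX c₁ c₂.inv = C.wordX c₁ c₂ := by
  have aux : ∀ c, C.wordX c₁ c ⊆ C.wordX c₁ c.inv := fun c z hz => by
    have h := neg_mem_wordX hC.1 (wordX_subset_swap hC.1 hz)
    rwa [neg_neg, wordX_inv_left hC] at h
  refine Set.Subset.antisymm (fun z hz => ?_) (aux c₂)
  simpa using aux _ hz

theorem wordX_eq (hC : C.IsNonHyperoctahedral) (c₁ c₂ d₁ d₂ : PColor) :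
    C.wordX c₁ c₂ = C.wordX d₁ d₂ := by
  rcases eq_or_eq_inv c₁ d₁ with rfl | rfl <;> rcases eq_or_eq_inv c₂ d₂ with rfl | rfl <;>
    simp [wordX_inv_left hC, wordX_inv_right hC]

end TCPartitionSet

/-! ### Classification of the possible sets of integers -/

open TCPartition TCPartitionSet

/-- The complement of `X` is also symmetric and `m`-periodic, hence determined by its residues up to
`m / 2`: a larger residue `r` is replaced by `m - r`. -/
theorem eq_univ_diff_symPeriodic {X : Set ℤ} {m : ℤ} (hm : 0 < m) (hneg : ∀ z ∈ X, -z ∈ X)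
    (hper : ∀ z ∈ X, ∀ t : ℤ, m * t + z ∈ X) :
    X = Set.univ \ symPeriodic {d | 0 ≤ d ∧ d ≤ m / 2 ∧ d ∉ X} m := by
  ext x
  simp only [Set.mem_sdiff, Set.mem_univ, true_and, symPeriodic]
  constructor
  · rintro hx ⟨d, ⟨-, -, hd⟩, z, rfl | rfl⟩
    · apply hd
      convert hper _ hx (-z) using 1
      ring
    · apply hd
      convert hper _ (hneg _ hx) (z + 1) using 1
      ring
  · intro h
    by_contra hx
    apply h
    have h₁ := Int.emod_nonneg x hm.ne'
    have h₂ := Int.emod_lt_of_pos x hm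
    have h₃ := Int.emod_add_mul_ediv x m
    by_cases hr : x % m ≤ m / 2
    · refine ⟨x % m, ⟨h₁, hr, fun hX => hx ?_⟩, x / m, Or.inl h₃.symm⟩
      convert hper _ hX (x / m) using 1
      linarith
    · refine ⟨m - x % m, ⟨by omega, by omega, fun hX => hx ?_⟩, x / m, Or.inr (by linarith)⟩
      convert hper _ (hneg _ hX) (x / m + 1) using 1
      linarith

theorem eq_univ_diff_symPeriodic_zero {X : Set ℤ} (hneg : ∀ z ∈ X, -z ∈ X) :
    X = Set.univ \ symPeriodic {d | 0 ≤ d ∧ d ∉ X} 0 := by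
  ext x
  simp only [Set.mem_sdiff, Set.mem_univ, true_and, symPeriodic]
  constructor
  · rintro hx ⟨d, ⟨-, hd⟩, z, rfl | rfl⟩
    · exact hd (by simpa using hx)
    · exact hd (by simpa using hneg _ hx)
  · intro h
    by_contra hx
    apply h
    rcases le_total 0 x with h0 | h0
    · exact ⟨x, ⟨h0, hx⟩, 0, Or.inl (by simp)⟩
    · exact ⟨-x, ⟨by omega, fun hX => hx (by simpa using hneg _ hX)⟩, 0, Or.inr (by simp)⟩

theorem AddSubgroup.exists_natCast_eq_intCoset (H : AddSubgroup ℤ) :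
    ∃ n : ℕ, (H : Set ℤ) = intCoset 0 n := by
  obtain ⟨a, rfl⟩ := Int.subgroup_cyclic H
  refine ⟨a.natAbs, ?_⟩
  ext x
  rw [SetLike.mem_coe, ← AddSubgroup.zmultiples_eq_closure, Int.mem_zmultiples_iff,
    ← Int.natAbs_dvd]
  simp [intCoset, dvd_def]

theorem mem_intCoset_zero {n : ℤ} {x : ℤ} : x ∈ intCoset 0 n ↔ n ∣ x := by
  simp [intCoset, dvd_def]

/-- With `K = nℤ`, the set `L` is empty or a coset `a + nℤ` with `2a ∈ nℤ`. So `L = K`, or `n = 2m`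
and `L = m + 2mℤ`; in the latter case `X` has the finer period `m`. -/
theorem exists_parameters (S K : AddSubgroup ℤ) (L X : Set ℤ) (hSK : S ≤ K)
    (hL : ∀ z ∈ L, -z ∈ L) (hKL : ∀ y ∈ K, ∀ z ∈ L, y + z ∈ L)
    (hLL : ∀ y ∈ L, ∀ z ∈ L, y + z ∈ K) (hX : ∀ z ∈ X, -z ∈ X)
    (hKX : ∀ y ∈ K, ∀ z ∈ X, y + z ∈ X) (hLX : ∀ y ∈ L, ∀ z ∈ X, y + z ∈ X) :
    ∃ (u m : ℕ) (D E : Set ℤ), 1 ≤ m ∧ D ⊆ Set.Icc 0 ((m : ℤ) / 2) ∧ E ⊆ Set.Ici 0 ∧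
      (((S : Set ℤ) = intCoset 0 (u * m) ∧ L = intCoset 0 m ∧ (K : Set ℤ) = intCoset 0 m ∧
          X = Set.univ \ symPeriodic D m) ∨
        ((S : Set ℤ) = intCoset 0 (2 * u * m) ∧ L = intCoset m (2 * m) ∧
          (K : Set ℤ) = intCoset 0 (2 * m) ∧ X = Set.univ \ symPeriodic D m) ∨
        ((S : Set ℤ) = intCoset 0 (u * m) ∧ L = ∅ ∧ (K : Set ℤ) = intCoset 0 m ∧
          X = Set.univ \ symPeriodic D m) ∨
        ((S : Set ℤ) = {0} ∧ L = {0} ∧ (K : Set ℤ) = {0} ∧ X = Set.univ \ symPeriodic E 0) ∨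
        ((S : Set ℤ) = {0} ∧ L = ∅ ∧ (K : Set ℤ) = {0} ∧ X = Set.univ \ symPeriodic E 0)) := by
  obtain ⟨n, hn⟩ := K.exists_natCast_eq_intCoset
  obtain ⟨s, hs⟩ := S.exists_natCast_eq_intCoset
  have hK : ∀ x, x ∈ K ↔ (n : ℤ) ∣ x := fun x => by
    rw [← SetLike.mem_coe, hn, mem_intCoset_zero]
  have hsK : (n : ℤ) ∣ s := (hK _).1 (hSK (by
    rw [← SetLike.mem_coe, hs, mem_intCoset_zero]))
  have hL' : ∀ {a}, a ∈ L → ∀ x, x ∈ L ↔ (n : ℤ) ∣ x - a := fun {a} ha x => by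
    rw [← hK]
    exact ⟨fun hx => sub_eq_add_neg x a ▸ hLL x hx _ (hL a ha),
      fun hx => by simpa using hKL _ hx a ha⟩
  have hXm : ∀ {m : ℤ}, (∀ t, m * t ∈ K) → ∀ z ∈ X, ∀ t : ℤ, m * t + z ∈ X :=
    fun h z hz t => hKX _ (h t) z hz
  rcases Nat.eq_zero_or_pos n with rfl | hpos
  · obtain rfl : s = 0 := by simpa using hsK
    have e : intCoset 0 ((0 : ℕ) : ℤ) = {0} := by
      ext x
      rw [mem_intCoset_zero]
      simp
    rw [e] at hn hs
    -- For `n = 0` the values of `u`, `m` and `D` are placeholders; only `E` matters.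
    refine ⟨0, 1, ∅, {d | 0 ≤ d ∧ d ∉ X}, le_rfl, Set.empty_subset _, fun d hd => hd.1, Or.inr (Or.inr (Or.inr ?_))⟩
    · rcases L.eq_empty_or_nonempty with h | ⟨a, ha⟩
      · exact Or.inr ⟨hs, h, hn, eq_univ_diff_symPeriodic_zero hX⟩
      · refine Or.inl ⟨hs, ?_, hn, eq_univ_diff_symPeriodic_zero hX⟩
        have h0 : a = 0 := by
          have := (hL' ha _).1 (hL a ha)
          simp only [Nat.cast_zero, zero_dvd_iff] at this
          omega
        subst h0
        ext x
        rw [hL' ha]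
        simp
  · have hpos' : (0 : ℤ) < n := by exact_mod_cast hpos
    obtain ⟨u, hu⟩ : ∃ u : ℕ, s = u * n := by
      obtain ⟨u, hu⟩ := Int.natCast_dvd_natCast.1 hsK
      exact ⟨u, by rw [hu, mul_comm]⟩
    have hper := hXm (m := n) fun t => (hK _).2 (Dvd.intro _ rfl)
    rcases L.eq_empty_or_nonempty with h | ⟨a, ha⟩
    · exact ⟨u, n, _, ∅, hpos, fun d hd => ⟨hd.1, hd.2.1⟩, Set.empty_subset _,
        Or.inr (Or.inr (Or.inl ⟨by rw [hs, hu]; push_cast; rfl, h, hn,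
          eq_univ_diff_symPeriodic hpos' hX hper⟩))⟩
    · by_cases hna : (n : ℤ) ∣ a
      · refine ⟨u, n, _, ∅, hpos, fun d hd => ⟨hd.1, hd.2.1⟩, Set.empty_subset _,
          Or.inl ⟨by rw [hs, hu]; push_cast; rfl, ?_, hn,
            eq_univ_diff_symPeriodic hpos' hX hper⟩⟩
        ext x
        rw [hL' ha, mem_intCoset_zero]
        exact dvd_sub_left hna
      · have h2 : (n : ℤ) ∣ a + a := (hK _).1 (hLL a ha a ha)
        obtain ⟨m, hm⟩ : ∃ m : ℕ, n = 2 * m := by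
          rcases Nat.even_or_odd n with ⟨m, hm⟩ | hodd
          · exact ⟨m, by omega⟩
          · exfalso
            apply hna
            -- An odd `n` dividing `2a` would divide `a`.
            have hc : IsCoprime (n : ℤ) 2 := by
              have := Nat.isCoprime_iff_coprime.2 (Nat.coprime_two_right.2 hodd)
              exact_mod_cast this
            exact hc.dvd_of_dvd_mul_left (by rwa [two_mul])
        subst hm
        have hmpos : 0 < m := by omega
        have hmL : (m : ℤ) ∈ L := by
          rw [hL' ha]
          obtain ⟨t, ht⟩ := h2
          push_cast at ht hna ⊢
          have hat : a = m * t := by linarith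
          rcases Int.even_or_odd' t with ⟨r, rfl | rfl⟩
          · exact absurd ⟨r, by rw [hat]; ring⟩ hna
          · exact ⟨-r, by rw [hat]; ring⟩
        have hmK : ∀ t : ℤ, 2 * (m : ℤ) * t ∈ K := fun t => by
          rw [hK]
          push_cast
          exact Dvd.intro _ rfl
        refine ⟨u, m, _, ∅, hmpos, fun d hd => ⟨hd.1, hd.2.1⟩, Set.empty_subset _,
          Or.inr (Or.inl ⟨by rw [hs, hu]; push_cast; congr 1; ring, ?_, by rw [hn]; push_cast; rfl,
            eq_univ_diff_symPeriodic (by exact_mod_cast hmpos) hX fun z hz t => ?_⟩)⟩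
        · ext x
          rw [hL' hmL]
          push_cast
          constructor
          · rintro ⟨t, ht⟩
            exact ⟨t, by linarith⟩
          · rintro ⟨t, rfl⟩
            exact ⟨t, by ring⟩
        -- Even multiples of `m` lie in `K`, odd ones in `L`, and both translate `X` into itself.
        · rcases Int.even_or_odd' t with ⟨r, rfl | rfl⟩
          · convert hKX _ (hmK r) z hz using 1
            ring
          · convert hLX _ (hKL _ (hmK r) _ hmL) z hz using 1
            ring

theorem proposition5p16 (C : TCPartitionSet) (hC : C.IsNonHyperoctahedral) :
    (C.L = TCPartitionSet.Kcol PColor.white PColor.white C ∧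
      C.L = TCPartitionSet.Kcol PColor.black PColor.black C) ∧
    (C.K = TCPartitionSet.Kcol PColor.white PColor.black C ∧
      C.K = TCPartitionSet.Kcol PColor.black PColor.white C) ∧
    (C.X = TCPartitionSet.Xcol PColor.white PColor.white C ∧
      C.X = TCPartitionSet.Xcol PColor.black PColor.black C ∧
      C.X = TCPartitionSet.Xcol PColor.white PColor.black C ∧
      C.X = TCPartitionSet.Xcol PColor.black PColor.white C) ∧
    ∃ (u m : ℕ) (D E : Set ℤ), 1 ≤ m ∧ D ⊆ Set.Icc 0 ((m : ℤ) / 2) ∧ E ⊆ Set.Ici 0 ∧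
      ((C.Sig = intCoset 0 (u * m) ∧ C.L = intCoset 0 m ∧ C.K = intCoset 0 m ∧
          C.X = Set.univ \ symPeriodic D m) ∨
        (C.Sig = intCoset 0 (2 * u * m) ∧ C.L = intCoset m (2 * m) ∧ C.K = intCoset 0 (2 * m) ∧
          C.X = Set.univ \ symPeriodic D m) ∨
        (C.Sig = intCoset 0 (u * m) ∧ C.L = ∅ ∧ C.K = intCoset 0 m ∧
          C.X = Set.univ \ symPeriodic D m) ∨
        (C.Sig = {0} ∧ C.L = {0} ∧ C.K = {0} ∧ C.X = Set.univ \ symPeriodic E 0) ∨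
        (C.Sig = {0} ∧ C.L = ∅ ∧ C.K = {0} ∧ C.X = Set.univ \ symPeriodic E 0)) := by
  have hc := hC.1
  have hKK : C.wordK black white = C.wordK white black := wordK_inv hC white black
  have hLL : C.wordK black black = C.wordK white white := wordK_inv hC white white
  have hL : C.L = C.wordK white white := by
    rw [L_eq, kcol_eq hc, kcol_eq hc, hLL, Set.union_self]
  have hK : C.K = C.wordK white black := by
    rw [K_eq, kcol_eq hc, kcol_eq hc, hKK, Set.union_self]
  have hX : C.X = C.wordX white white := by
    rw [X_eq, xcol_eq hc, xcol_eq hc, xcol_eq hc, xcol_eq hc, wordX_eq hC black black white white,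
      wordX_eq hC white black white white, wordX_eq hC black white white white, Set.union_self,
      Set.union_self]
  refine ⟨⟨?_, ?_⟩, ⟨?_, ?_⟩, ⟨?_, ?_, ?_, ?_⟩, ?_⟩
  · rw [hL, kcol_eq hc]
  · rw [hL, kcol_eq hc, hLL]
  · rw [hK, kcol_eq hc]
  · rw [hK, kcol_eq hc, hKK]
  · rw [hX, xcol_eq hc]
  · rw [hX, xcol_eq hc]; exact wordX_eq hC _ _ _ _
  · rw [hX, xcol_eq hc]; exact wordX_eq hC _ _ _ _
  · rw [hX, xcol_eq hc]; exact wordX_eq hC _ _ _ _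
  rw [sig_eq hc, hL, hK, hX]
  let S : AddSubgroup ℤ :=
    { carrier := C.wordSig
      add_mem' := add_mem_wordSig hc
      zero_mem' := zero_mem_wordSig hc
      neg_mem' := neg_mem_wordSig hc }
  let K : AddSubgroup ℤ :=
    { carrier := C.wordK white black
      add_mem' := fun hy hz => add_mem_wordK hc hy hz
      zero_mem' := wordSig_subset_wordK hc white (zero_mem_wordSig hc)
      neg_mem' := fun hz => neg_mem_wordK hc hz }
  refine exists_parameters S K _ _ (wordSig_subset_wordK hc white) (fun z hz => ?_)
    (fun y hy z hz => add_mem_wordK hc hy hz) (fun y hy z hz => ?_)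
    (fun z hz => wordX_subset_swap hc hz) (fun y hy z hz => add_mem_wordX hc hy hz)
    fun y hy z hz => ?_
  · rw [← hLL]
    exact neg_mem_wordK hc hz
  -- Gluing requires inverse colors, so a white-white distance is followed by a black-black one.
  · rw [← hLL] at hz
    exact add_mem_wordK hc hy hz
  · rw [wordX_eq hC white white black white] at hz
    exact add_mem_wordX hc hy hz
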